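/- Let $(R,\mathfrak m)$ be a one-dimensional Cohen-Macaulay local ring with total ring of fractions $\mathrm Q(R)$, and let $I\subsetneq R$ be a canonical ideal (a proper ideal isomorphic to a canonical module of $R$) containing a parameter ideal $(a)$ as a reduction, i.e. $I^{r+1}=aI^r$ for some $r\ge 0$. Put $K=I/a=\{x/a\mid x\in I\}\subseteq \mathrm Q(R)$, $S=R[K]$ and $\mathfrak c=R:S$. Let $\ell_R$ denote length and $\mu_R$ the minimal number of generators. For a one-dimensional Cohen-Macaulay local ring $(A,\mathfrak n)$ and an integer $n\ge 0$, $A$ is called $n$-Goto if there are a canonical ideal $I_A$ of $A$ and a parameter ideal $Q=(b)$ with $b\in I_A$ such that, with $J_A=I_A+Q$, $\mathcal R=A[J_At]$ and $\mathcal T=A[Qt]$, the Sally module $\mathcal S=J_A\mathcal R/J_A\mathcal T\cong\bigoplus_{i\ge1}J_A^{i+1}/J_AQ^i$ is generated over $\mathcal T$ by its homogeneous elements of degree one and has rank $n$, i.e. $\ell_{\mathcal T_{\mathfrak p}}(\mathcal S_{\mathfrak p})=n$ for $\mathfrak p=\mathfrak n\mathcal T$. For an ideal $J$ of $R$ and $\alpha\in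 R$, the quasi-trivial extension $R\overset{\alpha}{\ltimes}J$ is the ring with additive group $R\oplus J$ and multiplication $(a,x)(b,y)=(ab,\,ay+xb+\alpha xy)$; for $\alpha=0$ it is the idealization $R\ltimes J$. Let $n\ge 1$ be an integer. (A) Let $T$ be a ring with $R\subseteq T\subseteq \mathrm Q(R)$ that is finitely generated as an $R$-module, with $K\subseteq T$ and $T\ne R$, and put $J=R:T$. Then the following are equivalent: (1) $R\overset{\alpha}{\ltimes}J$ is $n$-Goto for every $\alpha\in R$; (2) $R\overset{\alpha}{\ltimes}J$ is $n$-Goto for some $\alpha\in R$; (3) the fiber product $R\times_{R/J}R$ is $n$-Goto; (4) the idealization $R\ltimes J$ is $n$-Goto; (5) $\ell_R(T/K)=n$; (6) $\ell_R(R/J)=n$. (B) The following are equivalent: (1) $R$ is $n$-Goto and $\mu_R(K^2/K)=1$; (2) the fiber product (amalgamated duplication) $A=R\times_{R/\mathfrak c}R$ is $n$-Goto and $\mu_A(L^2/L)=1$, where $L=\{(s,s+k)\mid s\in S,\ k\in K\}\subseteq \mathrm Q(R)\times \mathrm Q(R)$, the $A$-submodule corresponding to $S\times K\subseteq \mathrm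 Q(R)\overset{1}{\ltimes}\mathrm Q(R)$ under $(s,k)\mapsto(s,s+k)$; (3) the idealization $A=R\ltimes\mathfrak c$ is $n$-Goto and $\mu_A(L^2/L)=1$, where $L=S\times K\subseteq \mathrm Q(R)\ltimes \mathrm Q(R)$. -/

import Mathlib

universe u

set_option maxSynthPendingDepth 3

open scoped nonZeroDivisors Polynomial

noncomputable section

namespace GotoRing

/-- The subquotient `P / N` for submodules `N ⊆ P` of a module. -/
abbrev Subquotient {B M : Type*} [CommRing B] [AddCommGroup M] [Module B M]
    (P N : Submodule B M) : Type _ :=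
  P ⧸ N.submoduleOf P

/-! ### One-dimensional Cohen-Macaulay local rings and their canonical ideals -/

/-- One-dimensional Cohen-Macaulay local rings: Noetherian local rings of Krull dimension one whose
maximal ideal contains a non-zerodivisor (that is, of depth one). -/
class IsCohenMacaulayLocalDimOne (A : Type u) [CommRing A] : Prop
    extends IsLocalRing A, IsNoetherianRing A where
  krullDim_eq : ringKrullDim A = 1
  exists_regular : ∃ x ∈ IsLocalRing.maximalIdeal A, x ∈ A⁰

/-- `f : M → E` is an injective hull of `M`: an essential embedding into an injective module. -/
structure IsInjectiveHull {B M E : Type u} [CommRing B] [AddCommGroup M] [Module B M]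
    [AddCommGroup E] [Module B E] (f : M →ₗ[B] E) : Prop where
  injective : Function.Injective f
  injective_module : Module.Injective B E
  essential : ∀ P : Submodule B E, P ⊓ LinearMap.range f = ⊥ → P = ⊥

/-- `C` is a canonical module of the one-dimensional Cohen-Macaulay local ring `A` with maximal
ideal `𝔪` and residue field `k`: `C` is finitely generated, and there is `x ∈ 𝔪`, regular both
on `A` and on `C`, such that `C / xC` is a canonical module of the Artinian local ring `A / xA`,
i.e. the injective hull of its residue field `(A / xA) / 𝔪(A / xA) = k`. -/
def IsCanonicalModule (A : Type u) [CommRing A] [IsCohenMacaulayLocalDimOne A]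
    (C : Type u) [AddCommGroup C] [Module A C] : Prop :=
  Module.Finite A C ∧
    ∃ x ∈ IsLocalRing.maximalIdeal A, x ∈ A⁰ ∧ IsSMulRegular C x ∧
      ∃ f : ((A ⧸ Ideal.span {x}) ⧸
            (IsLocalRing.maximalIdeal A).map (Ideal.Quotient.mk (Ideal.span {x})))
          →ₗ[A ⧸ Ideal.span {x}] (C ⧸ (Ideal.span {x} • (⊤ : Submodule A C))),
        IsInjectiveHull f

/-- A canonical ideal: a proper ideal which, as a module, is a canonical module. -/
def IsCanonicalIdeal {A : Type u} [CommRing A] [IsCohenMacaulayLocalDimOne A]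
    (I : Ideal A) : Prop :=
  I ≠ ⊤ ∧ IsCanonicalModule A I

/-- `(a)` is a parameter ideal of the one-dimensional local ring `A`, i.e. it is `𝔪`-primary. -/
def IsParameter {A : Type u} [CommRing A] [IsLocalRing A] (a : A) : Prop :=
  (Ideal.span {a}).radical = IsLocalRing.maximalIdeal A

/-- For ideals `Q ⊆ J`: `Q` is a reduction of `J`, i.e. `J ^ (r + 1) = Q J ^ r` for some `r`. -/
def IsReduction {A : Type u} [CommRing A] (Q J : Ideal A) : Prop :=
  Q ≤ J ∧ ∃ r : ℕ, J ^ (r + 1) = Q * J ^ r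

/-! ### Sally modules and Goto rings

For ideals `Q ⊆ J` of `A`, let `𝓡 = A[Jt]` and `𝓣 = A[Qt]` be the Rees algebras inside `A[t]`. -/

section Sally

variable {A : Type u} [CommRing A] (Q J : Ideal A)

/-- The `𝓣`-submodule `J𝓡 = ⨁ J ^ (i + 1) t ^ i` of `A[t]`. -/
def idealMulRees (h : Q ≤ J) : Submodule (reesAlgebra Q) A[X] where
  carrier := {f | ∀ i, f.coeff i ∈ J ^ (i + 1)}
  zero_mem' i := by simp
  add_mem' hf hg i := by
    rw [Polynomial.coeff_add]
    exact Ideal.add_mem _ (hf i) (hg i)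
  smul_mem' g f hf i := by
    change ((g : A[X]) * f).coeff i ∈ _
    rw [Polynomial.coeff_mul]
    refine Ideal.sum_mem _ ?_
    rintro ⟨j, k⟩ e
    rw [← Finset.HasAntidiagonal.mem_antidiagonal.mp e, add_assoc, pow_add]
    exact Ideal.mul_mem_mul (Ideal.pow_right_mono h j (g.2 j)) (hf k)

/-- The `𝓣`-submodule `J𝓣 = ⨁ J Q ^ i t ^ i` of `A[t]`. -/
def idealMulReesBase : Submodule (reesAlgebra Q) A[X] where
  carrier := {f | ∀ i, f.coeff i ∈ J * Q ^ i}
  zero_mem' i := by simp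
  add_mem' hf hg i := by
    rw [Polynomial.coeff_add]
    exact Ideal.add_mem _ (hf i) (hg i)
  smul_mem' g f hf i := by
    change ((g : A[X]) * f).coeff i ∈ _
    rw [Polynomial.coeff_mul]
    refine Ideal.sum_mem _ ?_
    rintro ⟨j, k⟩ e
    rw [← Finset.HasAntidiagonal.mem_antidiagonal.mp e, pow_add, mul_left_comm]
    exact Ideal.mul_mem_mul (g.2 j) (hf k)

/-- The Sally module `S_Q(J) = J𝓡 / J𝓣 ≅ ⨁_{i ≥ 1} J ^ (i + 1) / J Q ^ i`, a module over `𝓣`. -/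
abbrev SallyModule (h : Q ≤ J) : Type u :=
  Subquotient (idealMulRees Q J h) (idealMulReesBase Q J)

/-- The Sally module is generated by its homogeneous elements of degree one, which are the classes
of the monomials `c t` with `c ∈ J ^ 2`. -/
def SallyGeneratedInDegreeOne (h : Q ≤ J) : Prop :=
  Submodule.span (reesAlgebra Q)
    {s : SallyModule Q J h | ∃ f : idealMulRees Q J h,
      (∃ c : A, (f : A[X]) = Polynomial.monomial 1 c) ∧ Submodule.Quotient.mk f = s} = ⊤

/-- The Sally module has rank `n`: its localization at the prime ideal `𝔭 = 𝔪𝓣` of `𝓣` has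
length `n` over `𝓣_𝔭`. -/
def SallyHasRank [IsLocalRing A] (h : Q ≤ J) (n : ℕ) : Prop :=
  ∃ _ : ((IsLocalRing.maximalIdeal A).map (algebraMap A (reesAlgebra Q))).IsPrime,
    Module.length
      (Localization.AtPrime
        ((IsLocalRing.maximalIdeal A).map (algebraMap A (reesAlgebra Q))))
      (LocalizedModule
        ((IsLocalRing.maximalIdeal A).map (algebraMap A (reesAlgebra Q))).primeCompl
        (SallyModule Q J h)) = n

end Sally

/-- `A` is an `n`-Goto ring (in dimension one): `A` is a one-dimensional Cohen-Macaulay local ring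
with a canonical ideal `I` and a parameter ideal `Q = (a)` such that `a ∈ I` and, for `J = I + Q`,
the Sally module `S_Q(J)` has rank `n` and is generated in degree one. -/
def IsGoto (n : ℕ) (A : Type u) [CommRing A] : Prop :=
  ∃ _ : IsCohenMacaulayLocalDimOne A, ∃ I : Ideal A, IsCanonicalIdeal I ∧
    ∃ a : A, IsParameter a ∧ a ∈ I ∧
      SallyHasRank (Ideal.span {a}) (I ⊔ Ideal.span {a}) le_sup_right n ∧
      SallyGeneratedInDegreeOne (Ideal.span {a}) (I ⊔ Ideal.span {a}) le_sup_right

/-- `μ_A(M)`, the minimal number of generators of a finitely generated module. -/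
def minGenerators (A M : Type*) [CommRing A] [AddCommGroup M] [Module A M] : ℕ :=
  (⊤ : Submodule A M).spanFinrank

/-! ### Fractional ideals in the total ring of fractions -/

section Fractional

variable {R : Type u} [CommRing R]

/-- `I / a = {x / a | x ∈ I}` inside the total ring of fractions (for a non-zerodivisor `a`). -/
def idealDiv (I : Ideal R) (a : R) : Submodule R (FractionRing R) where
  carrier := {y | ∃ x ∈ I, algebraMap R (FractionRing R) a * y = algebraMap R (FractionRing R) x}
  zero_mem' := ⟨0, I.zero_mem, by simp⟩
  add_mem' := by
    rintro y z ⟨x, hx, hy⟩ ⟨w, hw, hz⟩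
    exact ⟨x + w, I.add_mem hx hw, by rw [mul_add, hy, hz, map_add]⟩
  smul_mem' := by
    rintro r y ⟨x, hx, hy⟩
    exact ⟨r * x, I.mul_mem_left r hx, by
      rw [Algebra.smul_def, mul_left_comm, hy, map_mul]⟩

/-- `R : T = {r | r T ⊆ R}`. As `1 ∈ T`, it is contained in `R`. -/
def colonIdeal (T : Subalgebra R (FractionRing R)) : Ideal R where
  carrier := {r | ∀ t ∈ T, ∃ s : R,
    algebraMap R (FractionRing R) r * t = algebraMap R (FractionRing R) s}
  zero_mem' t _ := ⟨0, by simp⟩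
  add_mem' := by
    intro r r' hr hr' t ht
    obtain ⟨s, hs⟩ := hr t ht
    obtain ⟨s', hs'⟩ := hr' t ht
    exact ⟨s + s', by rw [map_add, add_mul, hs, hs', map_add]⟩
  smul_mem' := by
    intro c r hr t ht
    obtain ⟨s, hs⟩ := hr t ht
    exact ⟨c * s, by rw [smul_eq_mul, map_mul, mul_assoc, hs, map_mul]⟩

end Fractional

/-! ### Quasi-trivial extensions and fiber products -/

section Extensions

variable {R : Type u} [CommRing R]

/-- The quasi-trivial extension `R ⋉^α J`: pairs `(a, x)` with `a ∈ R` and `x ∈ J`, added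
componentwise and multiplied by `(a, x) (b, y) = (a b, a y + x b + α x y)`. It is realized inside
`R ⊕ R ω` with `ω² = α ω`, the pair `(a, x)` being `a + x ω`.
For `α = 0` it is the idealization `R ⋉ J`. -/
def quasiTrivialExtension (J : Ideal R) (α : R) : Subring (QuadraticAlgebra R 0 α) where
  carrier := {z | z.im ∈ J}
  zero_mem' := by simp
  one_mem' := J.zero_mem
  add_mem' := by
    intro z w hz hw
    exact J.add_mem hz hw
  neg_mem' := by
    intro z hz
    exact J.neg_mem hz
  mul_mem' := by
    intro z w hz hw
    have hz' : z.im ∈ J := hz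
    have hw' : w.im ∈ J := hw
    change (z * w).im ∈ J
    rw [QuadraticAlgebra.im_mul]
    exact J.add_mem (J.add_mem (J.mul_mem_left _ hw') (J.mul_mem_right _ hz'))
      (J.mul_mem_left _ hw')

theorem mem_quasiTrivialExtension {J : Ideal R} {α : R} {z : QuadraticAlgebra R 0 α} :
    z ∈ quasiTrivialExtension J α ↔ z.im ∈ J := Iff.rfl

/-- The product in `R ⋉^α J` is the one of the definition. -/
theorem quasiTrivialExtension_mul (J : Ideal R) (α : R) (z w : quasiTrivialExtension J α) :
    ((z * w : quasiTrivialExtension J α) : QuadraticAlgebra R 0 α) =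
      ⟨z.1.re * w.1.re, z.1.re * w.1.im + z.1.im * w.1.re + α * (z.1.im * w.1.im)⟩ := by
  ext <;> simp [mul_assoc]

/-- The idealization `R ⋉ J`, i.e. `(a, x) (b, y) = (a b, a y + x b)`. -/
abbrev Idealization (J : Ideal R) : Type u := quasiTrivialExtension J (0 : R)

/-- The total ring of fractions `Q(R) ⋉ Q(R)` of `R ⋉ J` (for a regular ideal `J`). -/
abbrev IdealizationFractions (R : Type u) [CommRing R] : Type u :=
  QuadraticAlgebra (FractionRing R) 0 0

/-- The inclusion `R ⋉ J → Q(R) ⋉ Q(R)`. -/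
def idealizationMap (J : Ideal R) : Idealization J →+* IdealizationFractions R where
  toFun z := ⟨algebraMap R (FractionRing R) z.1.re, algebraMap R (FractionRing R) z.1.im⟩
  map_one' := by
    ext
    · exact map_one (algebraMap R (FractionRing R))
    · exact map_zero (algebraMap R (FractionRing R))
  map_mul' z w := by ext <;> simp
  map_zero' := by ext <;> simp
  map_add' z w := by ext <;> simp

instance (J : Ideal R) : Algebra (Idealization J) (IdealizationFractions R) :=
  (idealizationMap J).toAlgebra

/-- The submodule `L = T × K` of `Q(R) ⋉ Q(R)` over `R ⋉ J`. (For `R ⊆ K ⊆ T` and `J = R : T` the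
set `T × K` is already a submodule.) -/
def idealizationCanonical (J : Ideal R) (T : Subalgebra R (FractionRing R))
    (K : Submodule R (FractionRing R)) :
    Submodule (Idealization J) (IdealizationFractions R) :=
  Submodule.span _ {z | z.re ∈ T ∧ z.im ∈ K}

/-- The fiber product `R ×_{R/J} R` of two copies of the canonical surjection `R → R/J`. -/
def fiberProduct (J : Ideal R) : Subring (R × R) :=
  RingHom.eqLocus ((Ideal.Quotient.mk J).comp (RingHom.fst R R))
    ((Ideal.Quotient.mk J).comp (RingHom.snd R R))

/-- The inclusion `R ×_{R/J} R → Q(R) × Q(R)`; the target is the total ring of fractions of the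
source (for a regular ideal `J`). -/
def fiberProductMap (J : Ideal R) : fiberProduct J →+* FractionRing R × FractionRing R :=
  ((algebraMap R (FractionRing R)).prodMap (algebraMap R (FractionRing R))).comp
    (fiberProduct J).subtype

instance (J : Ideal R) : Algebra (fiberProduct J) (FractionRing R × FractionRing R) :=
  (fiberProductMap J).toAlgebra

/-- The submodule `L` of `Q(R) × Q(R)` over `R ×_{R/J} R` that corresponds to `T × K` under the
isomorphism `Q(R) ⋉^1 Q(R) ≅ Q(R) × Q(R)`, `(s, k) ↦ (s, s + k)`, which restricts to
`R ⋉^1 J ≅ R ×_{R/J} R`. (For `R ⊆ K ⊆ T` and `J = R : T` the set is already a submodule.) -/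
def fiberProductCanonical (J : Ideal R) (T : Subalgebra R (FractionRing R))
    (K : Submodule R (FractionRing R)) :
    Submodule (fiberProduct J) (FractionRing R × FractionRing R) :=
  Submodule.span _ {z | ∃ s ∈ T, ∃ k ∈ K, z = (s, s + k)}

end Extensions

end GotoRing

end

noncomputable section

namespace GotoRing

/-! ### Relative lengths -/

section Length

variable {A R : Type*} [CommRing A] [CommRing R] {V W M N : Type*} [AddCommGroup V] [Module A V]
  [AddCommGroup W] [Module R W] [AddCommGroup M] [Module A M] [AddCommGroup N] [Module R N]

/-! Everything is read off from lattices in the total ring of fractions. A canonical lattice is a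
lattice `C` for which `(C : 𝔪) / C` is simple; up to multiplication by units these are exactly the
canonical ideals that contain a non-zerodivisor (`IsCanonicalIdeal.isCanonicalLattice`,
`IsCanonicalLattice.isCanonicalIdeal`). The map `F ↦ C : F` preserves lengths and is an involution
on lattices (`relLength_div`, `div_div_self`), whence `C : C = R` and the uniqueness of `C` up to a
unit.

Let `Q = (a)` with `a ∈ J` regular, and put `C = J / a`. The Sally module is generated in degree one
iff `J ^ 3 = Q J ^ 2`, that is `C ^ 3 = C ^ 2`; it is then the base change of `J ^ 2 / Q J` to the
Rees algebra of `Q`, a polynomial ring, so its rank is the length of `C ^ 2 / C`. Hence being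
`n`-Goto means that some canonical lattice `C` containing `1` satisfies `C ^ 3 = C ^ 2` and `ℓ(C ^ 2
/ C) = n` (`isGoto_iff_exists`). If the powers of one such `C` stabilize, this `C` decides the
matter (`isGoto_iff_of_isCanonicalLattice`).

For (A), `R : T = K : T`, and duality makes `L = T × K` a canonical lattice of `R ⋉^α J` inside
`Q(R) ⋉^α Q(R)`. One computes `L ^ 2 = L ^ 3 = T × T`, so `L ^ 2 / L` is `T / K`, and the extension
is `n`-Goto iff `ℓ(T / K) = n`, whatever `α` is. Idealization and fiber product are the cases `α =
0` and `α = 1`. Duality also turns `ℓ(T / K)` into `ℓ((K : K) / (K : T)) = ℓ(R / J)`.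

For (B), take `T = S`, which is a power of `K`. Both extension conditions say that `S / K` has
length `n` and needs exactly one generator. If `S / K` is cyclic and non-zero, Nakayama's lemma
forces `K ^ 2 = S` (`sq_eq_of_minGenerators_eq_one`), which links them to the condition on `R`. -/

theorem length_eq_of_bijective {σ : A →+* R} [RingHomSurjective σ] (f : M →ₛₗ[σ] N)
    (hf : Function.Bijective f) : Module.length A M = Module.length R N := by
  rw [Module.length, Module.length, WithBot.unbot_inj,
    Order.krullDim_eq_of_orderIso (Submodule.orderIsoMapComapOfBijective f hf)]

theorem minGenerators_eq_one_iff :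
    minGenerators A M = 1 ↔ (∃ g : M, ∀ x, ∃ r : A, r • g = x) ∧ Nontrivial M := by
  rw [minGenerators, Submodule.spanFinrank_eq_one_iff]
  refine and_congr ⟨?_, ?_⟩ ?_
  · rintro ⟨g, hg⟩
    refine ⟨g, fun x ↦ Submodule.mem_span_singleton.mp ?_⟩
    rw [← hg]
    trivial
  · rintro ⟨g, hg⟩
    exact ⟨g, (Submodule.eq_top_iff'.mpr fun x ↦ Submodule.mem_span_singleton.mpr (hg x)).symm⟩
  · rw [ne_comm, bot_ne_top_iff]
    exact Submodule.nontrivial_iff A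
where
  bot_ne_top_iff : ((⊥ : Submodule A M) ≠ ⊤) ↔ Nontrivial (Submodule A M) :=
    ⟨fun h ↦ ⟨_, _, h⟩, fun _ ↦ bot_ne_top⟩

theorem minGenerators_eq_one_iff_of_bijective {σ : A →+* R} [RingHomSurjective σ]
    (f : M →ₛₗ[σ] N) (hf : Function.Bijective f) :
    minGenerators A M = 1 ↔ minGenerators R N = 1 := by
  rw [minGenerators_eq_one_iff, minGenerators_eq_one_iff]
  refine and_congr ⟨?_, ?_⟩ (Equiv.ofBijective f hf).nontrivial_congr
  · rintro ⟨g, hg⟩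
    refine ⟨f g, fun x ↦ ?_⟩
    obtain ⟨y, rfl⟩ := hf.2 x
    obtain ⟨r, rfl⟩ := hg y
    exact ⟨σ r, (f.map_smulₛₗ r g).symm⟩
  · rintro ⟨g, hg⟩
    obtain ⟨g, rfl⟩ := hf.2 g
    refine ⟨g, fun x ↦ ?_⟩
    obtain ⟨r, hr⟩ := hg (f x)
    obtain ⟨r, rfl⟩ := RingHomSurjective.is_surjective (σ := σ) r
    exact ⟨r, hf.1 (by rw [f.map_smulₛₗ, hr])⟩

/-- The semilinear bijection of subquotients induced by an additive map `P → W`. -/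
theorem exists_bijective_subquotient {σ : A →+* R} [RingHomSurjective σ]
    {P₀ P : Submodule A V} {N₀ N : Submodule R W} (φ : V →+ W)
    (h₁ : ∀ x ∈ P, φ x ∈ N) (h₂ : ∀ y ∈ N, ∃ x ∈ P, φ x - y ∈ N₀)
    (h₃ : ∀ x ∈ P, (φ x ∈ N₀ ↔ x ∈ P₀))
    (h₄ : ∀ (r : A), ∀ x ∈ P, φ (r • x) - σ r • φ x ∈ N₀) :
    ∃ f : Subquotient P P₀ →ₛₗ[σ] Subquotient N N₀, Function.Bijective f := by
  let g : P →ₛₗ[σ] Subquotient N N₀ :=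
    { toFun := fun x ↦ Submodule.Quotient.mk ⟨φ x, h₁ x x.2⟩
      map_add' := fun x y ↦ by
        rw [← Submodule.Quotient.mk_add]
        congr 1
        ext
        simp
      map_smul' := fun r x ↦ by
        rw [← Submodule.Quotient.mk_smul, Submodule.Quotient.eq]
        exact h₄ r x x.2 }
  have hg : ∀ x : P, g x = 0 ↔ (x : V) ∈ P₀ := fun x ↦ by
    rw [← h₃ x x.2]
    exact Submodule.Quotient.mk_eq_zero _
  refine ⟨(P₀.submoduleOf P).liftQ g fun x hx ↦ (hg x).mpr hx, ?_, ?_⟩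
  · rw [injective_iff_map_eq_zero]
    intro x hx
    induction x using Submodule.Quotient.induction_on with
    | _ x =>
      exact (Submodule.Quotient.mk_eq_zero _).mpr ((hg x).mp hx)
  · intro y
    induction y using Submodule.Quotient.induction_on with
    | _ y =>
      obtain ⟨x, hx, hxy⟩ := h₂ y y.2
      refine ⟨Submodule.Quotient.mk ⟨x, hx⟩, ?_⟩
      exact (Submodule.Quotient.eq _).mpr hxy

/-- The length of `P / N`. -/
def relLength (N P : Submodule A V) : ℕ∞ := Module.length A (Subquotient P N)

theorem relLength_eq_of_addHom {σ : A →+* R} [RingHomSurjective σ]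
    {P₀ P : Submodule A V} {N₀ N : Submodule R W} (φ : V →+ W)
    (h₁ : ∀ x ∈ P, φ x ∈ N) (h₂ : ∀ y ∈ N, ∃ x ∈ P, φ x - y ∈ N₀)
    (h₃ : ∀ x ∈ P, (φ x ∈ N₀ ↔ x ∈ P₀))
    (h₄ : ∀ (r : A), ∀ x ∈ P, φ (r • x) - σ r • φ x ∈ N₀) :
    relLength P₀ P = relLength N₀ N := by
  obtain ⟨f, hf⟩ := exists_bijective_subquotient φ h₁ h₂ h₃ h₄
  exact length_eq_of_bijective f hf

theorem relLength_add {N P S : Submodule A V} (hNP : N ≤ P) (hPS : P ≤ S) :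
    relLength N S = relLength N P + relLength P S := by
  have hNS := hNP.trans hPS
  refine Module.length_eq_add_of_exact
    (Submodule.mapQ (N.submoduleOf P) (N.submoduleOf S) (Submodule.inclusion hPS)
      fun x hx ↦ hx)
    (Submodule.mapQ (N.submoduleOf S) (P.submoduleOf S) LinearMap.id fun x hx ↦ hNP hx) ?_ ?_ ?_
  · rw [injective_iff_map_eq_zero]
    intro x hx
    induction x using Submodule.Quotient.induction_on with
    | _ x =>
      have hx : (x : V) ∈ N := (Submodule.Quotient.mk_eq_zero (N.submoduleOf S)).mp hx
      exact (Submodule.Quotient.mk_eq_zero _).mpr hx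
  · intro y
    induction y using Submodule.Quotient.induction_on with
    | _ y => exact ⟨Submodule.Quotient.mk y, rfl⟩
  · intro y
    induction y using Submodule.Quotient.induction_on with
    | _ y =>
      constructor
      · intro hy
        exact ⟨Submodule.Quotient.mk ⟨y, (Submodule.Quotient.mk_eq_zero (P.submoduleOf S)).mp hy⟩, rfl⟩
      · rintro ⟨x, hx⟩
        induction x using Submodule.Quotient.induction_on with
        | _ x =>
          have h : (x : V) - y ∈ P := hNP ((Submodule.Quotient.eq (N.submoduleOf S)).mp hx)
          refine (Submodule.Quotient.mk_eq_zero _).mpr (?_ : (y : V) ∈ P)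
          simpa using P.sub_mem x.2 h

theorem relLength_eq_zero_iff {N P : Submodule A V} : relLength N P = 0 ↔ P ≤ N := by
  rw [relLength, Module.length_eq_zero_iff, Submodule.Quotient.subsingleton_iff,
    Submodule.submoduleOf_eq_top]

theorem relLength_self (N : Submodule A V) : relLength N N = 0 :=
  relLength_eq_zero_iff.mpr le_rfl

theorem relLength_bot_top : relLength (⊥ : Submodule A M) ⊤ = Module.length A M :=
  length_eq_of_bijective (σ := RingHom.id A)
    (((⊥ : Submodule A M).submoduleOf ⊤).liftQ (⊤ : Submodule A M).subtype (by
      intro x hx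
      exact hx))
    ⟨by
      rw [injective_iff_map_eq_zero]
      intro x hx
      induction x using Submodule.Quotient.induction_on with
      | _ x => exact (Submodule.Quotient.mk_eq_zero _).mpr hx, fun y ↦
      ⟨Submodule.Quotient.mk ⟨y, trivial⟩, rfl⟩⟩

theorem relLength_mono_right {N P S : Submodule A V} (hNP : N ≤ P) (hPS : P ≤ S) :
    relLength N P ≤ relLength N S := by
  rw [relLength_add hNP hPS]
  exact le_self_add

/-! ### Simple subquotients over a local ring. -/

variable [IsLocalRing A]

/-- Modulo `N`, an element `u` of `P` is some `r • s`; if `u ∉ N` then `r` is a unit because `𝔪 s ⊆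
N`. So any non-zero class generates `P / N`, which is therefore zero or simple. -/
theorem relLength_le_one {N P : Submodule A V} (s : V)
    (hm : ∀ r ∈ IsLocalRing.maximalIdeal A, r • s ∈ N)
    (hs : ∀ p ∈ P, ∃ r : A, p - r • s ∈ N) : relLength N P ≤ 1 := by
  by_cases hP : P ≤ N
  · rw [relLength_eq_zero_iff.mpr hP]
    exact zero_le_one
  rw [relLength]
  refine le_of_eq (Module.length_eq_one_iff.mpr ?_)
  have hnt : Nontrivial (Subquotient P N) := by
    rw [Submodule.Quotient.nontrivial_iff]
    rwa [Ne, Submodule.submoduleOf_eq_top]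
  rw [isSimpleModule_iff]
  refine ⟨fun U ↦ or_iff_not_imp_left.mpr fun hU ↦ ?_⟩
  obtain ⟨u, hu, hu0⟩ := U.ne_bot_iff.mp hU
  induction u using Submodule.Quotient.induction_on with
  | _ u =>
  have huN : (u : V) ∉ N := fun h ↦ hu0 ((Submodule.Quotient.mk_eq_zero _).mpr h)
  obtain ⟨r, hr⟩ := hs u u.2
  have hru : IsUnit r := by
    by_contra hru
    refine huN ?_
    have := N.add_mem hr (hm r hru)
    rwa [sub_add_cancel] at this
  obtain ⟨r, rfl⟩ := hru
  rw [eq_top_iff]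
  rintro p -
  induction p using Submodule.Quotient.induction_on with
  | _ p =>
  obtain ⟨t, ht⟩ := hs p p.2
  have : (Submodule.Quotient.mk p : Subquotient P N) =
      (t * ↑r⁻¹ : A) • Submodule.Quotient.mk u := by
    rw [← Submodule.Quotient.mk_smul, Submodule.Quotient.eq]
    change (p : V) - (t * ↑r⁻¹ : A) • (u : V) ∈ N
    have e : (p : V) - (t * ↑r⁻¹ : A) • (u : V) =
        (p - t • s) - (t * ↑r⁻¹ : A) • ((u : V) - (r : A) • s) := by
      rw [smul_sub, smul_smul, mul_assoc, Units.inv_mul, mul_one]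
      abel
    rw [e]
    exact N.sub_mem ht (N.smul_mem _ hr)
  rw [this]
  exact U.smul_mem _ hu

theorem relLength_eq_one {N P : Submodule A V} (s : V) (hsP : s ∈ P) (hsN : s ∉ N)
    (hm : ∀ r ∈ IsLocalRing.maximalIdeal A, r • s ∈ N)
    (hs : ∀ p ∈ P, ∃ r : A, p - r • s ∈ N) : relLength N P = 1 := by
  refine le_antisymm (relLength_le_one s hm hs) (Order.one_le_iff_ne_zero.mpr fun h ↦ ?_)
  exact hsN (relLength_eq_zero_iff.mp h hsP)

/-- A non-zero module of finite length has a minimal non-zero submodule, and each of its non-zero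
elements is killed by `𝔪`. This supplies the simple steps in the length inductions below. -/
theorem exists_smul_mem_of_relLength_ne_top {N P : Submodule A V} (h : relLength N P ≠ ⊤)
    (hP : ¬ P ≤ N) :
    ∃ g ∈ P, g ∉ N ∧ ∀ r ∈ IsLocalRing.maximalIdeal A, r • g ∈ N := by
  rw [relLength, Module.length_ne_top_iff, isFiniteLength_iff_isNoetherian_isArtinian] at h
  have := h.2
  have hnt : Nontrivial (Subquotient P N) := by
    rw [Submodule.Quotient.nontrivial_iff]
    rwa [Ne, Submodule.submoduleOf_eq_top]
  obtain ⟨U, hU, hmin⟩ := IsArtinian.set_has_minimal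
    {U : Submodule A (Subquotient P N) | U ≠ ⊥} ⟨⊤, top_ne_bot⟩
  obtain ⟨u, hu, hu0⟩ := U.ne_bot_iff.mp hU
  induction u using Submodule.Quotient.induction_on with
  | _ u =>
  refine ⟨u, u.2, fun h ↦ hu0 ((Submodule.Quotient.mk_eq_zero _).mpr h), fun r hr ↦ ?_⟩
  suffices h : (Submodule.Quotient.mk (r • u) : Subquotient P N) = 0 from
    (Submodule.Quotient.mk_eq_zero (N.submoduleOf P)).mp h
  by_contra hru
  rw [Submodule.Quotient.mk_smul] at hru
  have hle : Submodule.span A {r • (Submodule.Quotient.mk u : Subquotient P N)} ≤ U :=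
    (Submodule.span_singleton_le_iff_mem _ _).mpr (U.smul_mem _ hu)
  have hnlt := hmin (Submodule.span A {r • (Submodule.Quotient.mk u : Subquotient P N)})
    (mt Submodule.span_singleton_eq_bot.mp hru)
  have heq := eq_of_le_of_not_lt hle hnlt
  rw [← heq] at hu
  obtain ⟨t, ht⟩ := Submodule.mem_span_singleton.mp hu
  -- By minimality `r u` generates `U`, so `u = t r u` with `t r ∈ 𝔪`, and `1 - t r` is a unit
  -- killing `u`.
  have hunit : IsUnit (1 - t * r) := by
    by_contra hn
    have h1 := (IsLocalRing.maximalIdeal A).add_mem hn (Ideal.mul_mem_left _ t hr)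
    rw [sub_add_cancel] at h1
    exact (Ideal.ne_top_iff_one _).mp (IsLocalRing.maximalIdeal.isMaximal A).ne_top h1
  refine hu0 ((hunit.smul_eq_zero).mp ?_)
  rw [sub_smul, one_smul, mul_smul, ht, sub_self]

/-- Comparison of lengths under an order-reversing map between submodule lattices. -/
theorem relLength_le_of_antitone [IsLocalRing R] (F : Submodule A V → Submodule R W)
    (hF : ∀ N P : Submodule A V, N ≤ P → F P ≤ F N) {N P : Submodule A V} (hNP : N ≤ P)
    (hstep : ∀ Q : Submodule A V, N ≤ Q → Q ≤ P → ∀ g ∈ P,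
      (∀ r ∈ IsLocalRing.maximalIdeal A, r • g ∈ Q) →
        relLength (F (Q ⊔ Submodule.span A {g})) (F Q) ≤ 1)
    (h : relLength N P ≠ ⊤) : relLength (F P) (F N) ≤ relLength N P := by
  obtain ⟨n, hn⟩ := ENat.ne_top_iff_exists.mp h
  induction n using Nat.strong_induction_on generalizing N with
  | _ n ih =>
  by_cases hPN : P ≤ N
  · obtain rfl := le_antisymm hNP hPN
    rw [relLength_self, relLength_self]
  obtain ⟨g, hgP, hgN, hg⟩ := exists_smul_mem_of_relLength_ne_top h hPN
  have hgP' : N ⊔ Submodule.span A {g} ≤ P :=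
    sup_le hNP ((Submodule.span_singleton_le_iff_mem _ _).mpr hgP)
  have hone : relLength N (N ⊔ Submodule.span A {g}) = 1 := by
    refine relLength_eq_one g
      (le_sup_right (a := N) (Submodule.mem_span_singleton_self g)) hgN hg fun p hp ↦ ?_
    obtain ⟨y, hy, z, hz, rfl⟩ := Submodule.mem_sup.mp hp
    obtain ⟨r, rfl⟩ := Submodule.mem_span_singleton.mp hz
    exact ⟨r, by simpa using hy⟩
  have hadd := relLength_add (N := N) le_sup_left hgP'
  have hne : relLength (N ⊔ Submodule.span A {g}) P ≠ ⊤ := fun ht ↦ h (by rw [hadd, ht, add_top])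
  obtain ⟨m, hm⟩ := ENat.ne_top_iff_exists.mp hne
  -- Enlarging `N` by the socle element `g` costs exactly one, so the induction applies to the rest
  -- of the way up to `P`.
  have hmn : m < n := by
    rw [← hn, hone, ← hm] at hadd
    have : n = 1 + m := by exact_mod_cast hadd
    omega
  have h1 := ih m hmn hgP' (fun Q hQ ↦ hstep Q (le_sup_left.trans hQ)) hne hm
  rw [relLength_add (hF _ _ hgP') (hF _ _ le_sup_left), hadd, hone, add_comm]
  exact add_le_add (hstep N le_rfl hNP g hgP hg) h1

end Length

/-! ### Lattices in the total ring of fractions -/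

section Lattice

open IsLocalRing (maximalIdeal)

/-! ### Colon submodules and multiples by units. -/

section Submodule

variable {R Q : Type*} [CommRing R] [CommRing Q] [Algebra R Q]

theorem div_mul_eq (C F G : Submodule R Q) : C / (F * G) = (C / F) / G := by
  refine le_antisymm ?_ ?_
  · rw [Submodule.le_div_iff_mul_le, Submodule.le_div_iff_mul_le, mul_assoc, mul_comm G F,
      ← Submodule.le_div_iff_mul_le]
  · rw [Submodule.le_div_iff_mul_le, mul_comm F G, ← mul_assoc, ← Submodule.le_div_iff_mul_le,
      ← Submodule.le_div_iff_mul_le]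

theorem div_antitone (C : Submodule R Q) {F G : Submodule R Q} (h : F ≤ G) : C / G ≤ C / F := by
  intro q hq
  rw [Submodule.mem_div_iff_forall_mul_mem] at hq ⊢
  exact fun y hy ↦ hq y (h hy)

theorem le_div_div (C F : Submodule R Q) : F ≤ C / (C / F) := by
  rw [Submodule.le_div_iff_mul_le, mul_comm, ← Submodule.le_div_iff_mul_le]

theorem div_one_eq (C : Submodule R Q) : C / 1 = C := by
  refine le_antisymm (fun q hq ↦ ?_) ?_
  · rw [Submodule.mem_div_iff_forall_mul_mem] at hq
    simpa using hq 1 (Submodule.one_le.mp le_rfl)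
  · rw [Submodule.le_div_iff_mul_le, mul_one]

/-- The multiple `u F` of a submodule by a unit. -/
def scale (u : Qˣ) (F : Submodule R Q) : Submodule R Q := Submodule.span R {(u : Q)} * F

theorem mem_scale {u : Qˣ} {F : Submodule R Q} {q : Q} :
    q ∈ scale u F ↔ ∃ z ∈ F, (u : Q) * z = q :=
  Submodule.mem_span_singleton_mul

theorem mul_mem_scale (u : Qˣ) {F : Submodule R Q} {q : Q} (hq : q ∈ F) :
    (u : Q) * q ∈ scale u F :=
  mem_scale.mpr ⟨q, hq, rfl⟩

theorem mul_mem_scale_iff {u : Qˣ} {F : Submodule R Q} {q : Q} :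
    (u : Q) * q ∈ scale u F ↔ q ∈ F := by
  refine ⟨fun h ↦ ?_, mul_mem_scale u⟩
  obtain ⟨z, hz, h⟩ := mem_scale.mp h
  rwa [← u.isUnit.mul_left_cancel h]

theorem scale_scale (u v : Qˣ) (F : Submodule R Q) : scale u (scale v F) = scale (u * v) F := by
  rw [scale, scale, scale, ← mul_assoc, Submodule.span_mul_span, Set.singleton_mul_singleton,
    Units.val_mul]

theorem scale_one (F : Submodule R Q) : scale 1 F = F := by
  rw [scale, Units.val_one, ← Submodule.one_eq_span, one_mul]

theorem scale_inv_scale (u : Qˣ) (F : Submodule R Q) : scale u⁻¹ (scale u F) = F := by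
  rw [scale_scale, inv_mul_cancel, scale_one]

theorem scale_scale_inv (u : Qˣ) (F : Submodule R Q) : scale u (scale u⁻¹ F) = F := by
  rw [scale_scale, mul_inv_cancel, scale_one]

theorem scale_mono (u : Qˣ) {F G : Submodule R Q} (h : F ≤ G) : scale u F ≤ scale u G :=
  mul_le_mul_right h _

theorem scale_mul_scale (u v : Qˣ) (F G : Submodule R Q) :
    scale u F * scale v G = scale (u * v) (F * G) := by
  rw [scale, scale, scale, mul_mul_mul_comm, Submodule.span_mul_span,
    Set.singleton_mul_singleton, Units.val_mul]

theorem scale_pow (u : Qˣ) (F : Submodule R Q) (n : ℕ) : scale u F ^ n = scale (u ^ n) (F ^ n) := by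
  induction n with
  | zero => rw [pow_zero, pow_zero, pow_zero, scale_one]
  | succ n ih => rw [pow_succ, ih, scale_mul_scale, pow_succ, pow_succ]

theorem div_scale (C : Submodule R Q) (u : Qˣ) (F : Submodule R Q) :
    C / scale u F = scale u⁻¹ (C / F) := by
  ext q
  rw [mem_scale, Submodule.mem_div_iff_forall_mul_mem]
  constructor
  · intro h
    refine ⟨u * q, ?_, by rw [Units.inv_mul_cancel_left]⟩
    rw [Submodule.mem_div_iff_forall_mul_mem]
    intro y hy
    have := h _ (mul_mem_scale u hy)
    rwa [← mul_assoc, mul_comm q] at this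
  · rintro ⟨z, hz, rfl⟩ y hy
    obtain ⟨w, hw, rfl⟩ := mem_scale.mp hy
    rw [mul_mul_mul_comm, Units.inv_mul, one_mul]
    exact Submodule.mem_div_iff_forall_mul_mem.mp hz w hw

theorem relLength_scale (u : Qˣ) (F G : Submodule R Q) :
    relLength (scale u F) (scale u G) = relLength F G := by
  refine (relLength_eq_of_addHom (σ := RingHom.id R) (AddMonoidHom.mulLeft (u : Q))
    ?_ ?_ ?_ ?_).symm
  · intro x hx
    exact mul_mem_scale u hx
  · intro y hy
    obtain ⟨z, hz, rfl⟩ := mem_scale.mp hy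
    exact ⟨z, hz, by simp⟩
  · intro x _
    exact mul_mem_scale_iff
  · intro r x _
    simp

end Submodule

variable {R : Type*} [CommRing R]

/-- `M` is a finite module over `R / wR`, which is Noetherian of dimension at most zero since `w` is
regular, hence Artinian. -/
theorem length_ne_top_of_smul_eq_zero [IsCohenMacaulayLocalDimOne R] {M : Type*} [AddCommGroup M]
    [Module R M] [Module.Finite R M] {w : R} (hw : w ∈ R⁰) (h : ∀ m : M, w • m = 0) :
    Module.length R M ≠ ⊤ := by
  have hdim : ringKrullDim (R ⧸ Ideal.span {w}) ≤ 0 := by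
    have h1 := ringKrullDim_quotient_succ_le_of_nonZeroDivisor hw
    rw [IsCohenMacaulayLocalDimOne.krullDim_eq (A := R)] at h1
    exact ENat.WithBot.add_le_add_natCast_right_iff.mp (h1 : _ + ((1 : ℕ) : WithBot ℕ∞) ≤ 0 + 1)
  have : Ring.KrullDimLE 0 (R ⧸ Ideal.span {w}) := (Ring.krullDimLE_iff).mpr (by simpa using hdim)
  have : IsArtinianRing (R ⧸ Ideal.span {w}) :=
    IsNoetherianRing.isArtinianRing_of_krullDimLE_zero
  have htors : Module.IsTorsionBySet R M (Ideal.span {w}) := by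
    exact (Module.isTorsionBySet_span_singleton_iff w).mpr h
  let _ := htors.module
  have : IsScalarTower R (R ⧸ Ideal.span {w}) M := htors.isScalarTower
  have : Module.Finite (R ⧸ Ideal.span {w}) M := Module.Finite.of_restrictScalars_finite R _ M
  rw [Module.length_eq_of_surjective (S := R) (R := R ⧸ Ideal.span {w})
    Ideal.Quotient.mk_surjective]
  exact Module.length_ne_top

variable {Q : Type*} [CommRing Q] [Algebra R Q]

/-- Submodules of the total ring of fractions which are contained in a cyclic module and contain a
non-zerodivisor. -/
structure IsLattice (F : Submodule R Q) : Prop where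
  exists_mem : ∃ y ∈ R⁰, algebraMap R Q y ∈ F
  exists_denominator : ∃ z ∈ R⁰, ∀ q ∈ F, ∃ r, algebraMap R Q z * q = algebraMap R Q r

/-- Lattices `C` such that `(C : 𝔪) / C` is simple. -/
structure IsCanonicalLattice [IsLocalRing R] (C : Submodule R Q) : Prop extends IsLattice C where
  exists_socle : ∃ s ∉ C, (∀ r ∈ maximalIdeal R, r • s ∈ C) ∧
    ∀ q, (∀ r ∈ maximalIdeal R, r • q ∈ C) → ∃ r : R, q - r • s ∈ C

variable [IsFractionRing R Q]

theorem isUnit_algebraMap {x : R} (hx : x ∈ R⁰) : IsUnit (algebraMap R Q x) :=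
  IsLocalization.map_units Q ⟨x, hx⟩

omit [IsFractionRing R Q] in
theorem isLattice_one : IsLattice (1 : Submodule R Q) where
  exists_mem := ⟨1, one_mem _, Submodule.algebraMap_mem 1⟩
  exists_denominator := by
    refine ⟨1, one_mem _, fun q hq ↦ ?_⟩
    obtain ⟨r, rfl⟩ := Submodule.mem_one.mp hq
    exact ⟨r, by simp⟩

theorem exists_mul_eq_of_unit (u : Qˣ) :
    ∃ a ∈ R⁰, ∃ b ∈ R⁰, algebraMap R Q b * u = algebraMap R Q a := by
  obtain ⟨⟨a, b⟩, h⟩ := IsLocalization.surj R⁰ (u : Q)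
  refine ⟨a, ?_, b, b.2, by rw [mul_comm]; exact h⟩
  have hu : IsUnit (algebraMap R Q a) := by
    rw [← h]
    exact u.isUnit.mul (isUnit_algebraMap b.2)
  rw [mem_nonZeroDivisors_iff_right]
  intro x hx
  apply IsFractionRing.injective R Q
  rw [map_zero]
  refine (hu.mul_left_eq_zero).mp ?_
  rw [← map_mul, hx, map_zero]

theorem IsLattice.scale {F : Submodule R Q} (hF : IsLattice F) (u : Qˣ) :
    IsLattice (scale u F) := by
  obtain ⟨a, ha, b, hb, hu⟩ := exists_mul_eq_of_unit (R := R) u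
  obtain ⟨y, hy, hyF⟩ := hF.exists_mem
  obtain ⟨z, hz, hzF⟩ := hF.exists_denominator
  refine ⟨⟨a * y, mul_mem ha hy, ?_⟩, ⟨z * b, mul_mem hz hb, ?_⟩⟩
  · rw [map_mul, ← hu, mul_assoc, ← Algebra.smul_def]
    exact Submodule.smul_mem _ _ (mul_mem_scale u hyF)
  · intro q hq
    obtain ⟨w, hw, rfl⟩ := mem_scale.mp hq
    obtain ⟨r, hr⟩ := hzF w hw
    exact ⟨a * r, by rw [map_mul, map_mul, ← hu, ← hr]; ring⟩

/-- A non-zerodivisor as a unit of the total ring of fractions. -/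
def toUnit (Q : Type*) [CommRing Q] [Algebra R Q] [IsFractionRing R Q] {x : R} (hx : x ∈ R⁰) : Qˣ :=
  (isUnit_algebraMap (Q := Q) hx).unit

@[simp]
theorem coe_toUnit {x : R} (hx : x ∈ R⁰) : (toUnit Q hx : Q) = algebraMap R Q x := rfl

/-- A denominator `z` of `F` moves `F` into `R`, and a regular `y ∈ G` moves `R` into `G`; take `x =
y z`. This makes any two lattices commensurable. -/
theorem IsLattice.exists_scale_le {F G : Submodule R Q} (hF : IsLattice F) (hG : IsLattice G) :
    ∃ x, ∃ hx : x ∈ R⁰, GotoRing.scale (toUnit Q hx) F ≤ G := by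
  obtain ⟨y, hy, hyG⟩ := hG.exists_mem
  obtain ⟨z, hz, hzF⟩ := hF.exists_denominator
  refine ⟨y * z, mul_mem hy hz, fun q hq ↦ ?_⟩
  obtain ⟨w, hw, rfl⟩ := mem_scale.mp hq
  obtain ⟨r, hr⟩ := hzF w hw
  have : (toUnit Q (mul_mem hy hz) : Q) * w = r • algebraMap R Q y := by
    rw [coe_toUnit, map_mul, mul_assoc, hr, Algebra.smul_def, mul_comm]
  rw [this]
  exact G.smul_mem _ hyG

omit [IsFractionRing R Q] in
theorem IsLattice.div {C F : Submodule R Q} (hC : IsLattice C) (hF : IsLattice F) :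
    IsLattice (C / F) := by
  obtain ⟨y, hy, hyC⟩ := hC.exists_mem
  obtain ⟨z, hz, hzF⟩ := hF.exists_denominator
  obtain ⟨y', hy', hyF⟩ := hF.exists_mem
  obtain ⟨z', hz', hzC⟩ := hC.exists_denominator
  refine ⟨⟨y * z, mul_mem hy hz, ?_⟩, ⟨z' * y', mul_mem hz' hy', ?_⟩⟩
  · rw [Submodule.mem_div_iff_forall_mul_mem]
    intro q hq
    obtain ⟨r, hr⟩ := hzF q hq
    rw [map_mul, mul_assoc, hr, mul_comm, ← Algebra.smul_def]
    exact C.smul_mem _ hyC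
  · intro q hq
    obtain ⟨r, hr⟩ := hzC _ (Submodule.mem_div_iff_forall_mul_mem.mp hq _ hyF)
    exact ⟨r, by rw [← hr, map_mul]; ring⟩

omit [IsFractionRing R Q] in
theorem IsLattice.mul {F G : Submodule R Q} (hF : IsLattice F) (hG : IsLattice G) :
    IsLattice (F * G) := by
  obtain ⟨y, hy, hyC⟩ := hF.exists_mem
  obtain ⟨z, hz, hzF⟩ := hF.exists_denominator
  obtain ⟨y', hy', hyF⟩ := hG.exists_mem
  obtain ⟨z', hz', hzC⟩ := hG.exists_denominator
  refine ⟨⟨y * y', mul_mem hy hy', ?_⟩, ⟨z * z', mul_mem hz hz', fun q hq ↦ ?_⟩⟩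
  · rw [map_mul]
    exact Submodule.mul_mem_mul hyC hyF
  · induction hq using Submodule.mul_induction_on' with
    | mem_mul_mem f hf g hg =>
      obtain ⟨r, hr⟩ := hzF f hf
      obtain ⟨r', hr'⟩ := hzC g hg
      exact ⟨r * r', by rw [map_mul, map_mul, ← hr, ← hr']; ring⟩
    | add x _ y _ hx hy =>
      obtain ⟨r, hr⟩ := hx
      obtain ⟨r', hr'⟩ := hy
      exact ⟨r + r', by rw [mul_add, hr, hr', map_add]⟩

theorem IsLattice.finite [IsNoetherianRing R] {F : Submodule R Q} (hF : IsLattice F) :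
    Module.Finite R F := by
  obtain ⟨z, hz, hzF⟩ := hF.exists_denominator
  have hle : GotoRing.scale (toUnit Q hz) F ≤ 1 := by
    intro q hq
    obtain ⟨w, hw, rfl⟩ := mem_scale.mp hq
    obtain ⟨r, hr⟩ := hzF w hw
    rw [coe_toUnit, hr]
    exact Submodule.algebraMap_mem r
  have hnoeth : IsNoetherian R (1 : Submodule R Q) := by
    rw [Submodule.one_eq_range]
    infer_instance
  let f : F →ₗ[R] (1 : Submodule R Q) :=
    ((LinearMap.mulLeft R (toUnit Q hz : Q)).restrict fun q hq ↦ hle (mul_mem_scale _ hq))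
  have hf : Function.Injective f := by
    intro x y hxy
    have h : (toUnit Q hz : Q) * x = (toUnit Q hz : Q) * y := congrArg Subtype.val hxy
    exact Subtype.ext ((toUnit Q hz).isUnit.mul_left_cancel h)
  have := isNoetherian_of_injective f hf
  infer_instance

theorem IsLattice.relLength_ne_top [IsCohenMacaulayLocalDimOne R] {F G : Submodule R Q}
    (hF : IsLattice F) (hG : IsLattice G) : relLength F G ≠ ⊤ := by
  obtain ⟨x, hx, h⟩ := hG.exists_scale_le hF
  have := hG.finite
  refine length_ne_top_of_smul_eq_zero hx fun m ↦ ?_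
  induction m using Submodule.Quotient.induction_on with
  | _ m =>
  rw [← Submodule.Quotient.mk_smul]
  refine (Submodule.Quotient.mk_eq_zero _).mpr ?_
  change x • (m : Q) ∈ F
  rw [Algebra.smul_def, ← coe_toUnit hx]
  exact h (mul_mem_scale _ m.2)

variable [IsCohenMacaulayLocalDimOne R]

/-- For `F ⊆ G`, compute `ℓ(G / xF)` through `F` and through `xG`, and cancel `ℓ(xG / xF) = ℓ(G /
F)`, which is finite. The general case follows by replacing `F` by a multiple inside `G`. -/
theorem IsLattice.relLength_scale_self {F G : Submodule R Q} (hF : IsLattice F) (hG : IsLattice G)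
    {x : R} (hx : x ∈ R⁰) :
    relLength (GotoRing.scale (toUnit Q hx) F) F = relLength (GotoRing.scale (toUnit Q hx) G) G := by
  have hle : ∀ F : Submodule R Q, GotoRing.scale (toUnit Q hx) F ≤ F := fun F q hq ↦ by
    obtain ⟨w, hw, rfl⟩ := mem_scale.mp hq
    rw [coe_toUnit, ← Algebra.smul_def]
    exact F.smul_mem _ hw
  have key : ∀ F G : Submodule R Q, IsLattice F → IsLattice G → F ≤ G →
      relLength (GotoRing.scale (toUnit Q hx) F) F =
        relLength (GotoRing.scale (toUnit Q hx) G) G := by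
    intro F G hF hG hFG
    have h1 := relLength_add (hle F) hFG
    have h2 := relLength_add (scale_mono (toUnit Q hx) hFG) (hle G)
    rw [relLength_scale, h1, add_comm] at h2
    exact ENat.add_right_injective_of_ne_top (hF.relLength_ne_top hG) h2
  obtain ⟨y, hy, h⟩ := hF.exists_scale_le hG
  rw [← key _ _ (hF.scale (toUnit Q hy)) hG h, scale_scale, mul_comm, ← scale_scale,
    relLength_scale]

/-! ### Duality with respect to a canonical lattice. -/

namespace IsCanonicalLattice

variable {C : Submodule R Q} (hC : IsCanonicalLattice C)

include hC

omit [IsFractionRing R Q] in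
-- Multiplication by `g` sends `C : F` into `C : 𝔪`, because `𝔪 g ⊆ F`, and the elements it sends
-- into `C` are those of `C : (F + R g)`. So the quotient embeds into the simple module `(C : 𝔪) /
-- C`.
theorem relLength_div_le_one (F : Submodule R Q) (g : Q)
    (hg : ∀ r ∈ maximalIdeal R, r • g ∈ F) :
    relLength (C / (F ⊔ Submodule.span R {g})) (C / F) ≤ 1 := by
  have hmem : ∀ q, q ∈ C / F → q * g ∈ C → q ∈ C / (F ⊔ Submodule.span R {g}) := by
    intro q hq hqg
    rw [Submodule.mem_div_iff_forall_mul_mem] at hq ⊢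
    intro y hy
    obtain ⟨f, hf, z, hz, rfl⟩ := Submodule.mem_sup.mp hy
    obtain ⟨r, rfl⟩ := Submodule.mem_span_singleton.mp hz
    rw [mul_add, mul_smul_comm]
    exact C.add_mem (hq f hf) (C.smul_mem _ hqg)
  by_cases h : ∀ q ∈ C / F, q * g ∈ C
  · rw [relLength_eq_zero_iff.mpr fun q hq ↦ hmem q hq (h q hq)]
    exact zero_le_one
  push Not at h
  obtain ⟨q, hq, hqg⟩ := h
  obtain ⟨s, -, hms, hs⟩ := hC.exists_socle
  have hsoc : ∀ p ∈ C / F, ∀ r ∈ maximalIdeal R, r • (p * g) ∈ C := fun p hp r hr ↦ by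
    rw [← mul_smul_comm]
    exact Submodule.mem_div_iff_forall_mul_mem.mp hp _ (hg r hr)
  refine relLength_le_one q (fun r hr ↦ hmem _ (Submodule.smul_mem _ r hq) ?_) fun p hp ↦ ?_
  · rw [smul_mul_assoc]
    exact hsoc q hq r hr
  obtain ⟨t, ht⟩ := hs _ (hsoc q hq)
  obtain ⟨t', ht'⟩ := hs _ (hsoc p hp)
  have htu : IsUnit t := by
    by_contra htu
    exact hqg (by simpa using C.add_mem ht (hms t htu))
  obtain ⟨t, rfl⟩ := htu
  refine ⟨t' * ↑t⁻¹, hmem _ (Submodule.sub_mem _ hp (Submodule.smul_mem _ _ hq)) ?_⟩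
  have e : (p - (t' * ↑t⁻¹ : R) • q) * g =
      (p * g - t' • s) - (t' * ↑t⁻¹ : R) • (q * g - (t : R) • s) := by
    rw [sub_mul, smul_sub, smul_smul, mul_assoc t', Units.inv_mul, mul_one, smul_mul_assoc]
    abel
  rw [e]
  exact C.sub_mem ht' (C.smul_mem _ ht)

theorem relLength_div_le {F G : Submodule R Q} (hF : IsLattice F) (hG : IsLattice G)
    (hFG : F ≤ G) : relLength (C / G) (C / F) ≤ relLength F G :=
  relLength_le_of_antitone (C / ·) (fun _ _ h ↦ div_antitone C h) hFG
    (fun F _ _ g _ hg ↦ hC.relLength_div_le_one F g hg) (hF.relLength_ne_top hG)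

/-- Dualizing cannot increase the lengths of the two steps of `xG ⊆ F ⊆ G`. The total is preserved,
since `C : xG = x⁻¹ (C : G)` and `ℓ(D / xD)` is the same for all lattices `D`. Hence each step is
preserved. -/
theorem relLength_div {F G : Submodule R Q} (hF : IsLattice F) (hG : IsLattice G)
    (hFG : F ≤ G) : relLength (C / G) (C / F) = relLength F G := by
  obtain ⟨x, hx, h⟩ := hG.exists_scale_le hF
  have hxG := hG.scale (toUnit Q hx)
  have h1 := hC.relLength_div_le hF hG hFG
  have h2 := hC.relLength_div_le hxG hF h
  have h3 := relLength_add h hFG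
  have h4 := relLength_add (div_antitone C hFG) (div_antitone C h)
  have hD := (hC.toIsLattice.div hG).scale (toUnit Q hx)⁻¹
  have h5 : relLength (C / G) (C / scale (toUnit Q hx) G) = relLength (scale (toUnit Q hx) G) G := by
    rw [div_scale, ← hD.relLength_scale_self hG, scale_scale_inv]
  rw [h5, h3] at h4
  have hn1 := hF.relLength_ne_top hG
  have hn2 := hxG.relLength_ne_top hF
  refine le_antisymm h1 ?_
  have h6 : relLength (scale (toUnit Q hx) G) F + relLength F G ≤
      relLength (scale (toUnit Q hx) G) F + relLength (C / G) (C / F) := by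
    rw [h4, add_comm]
    gcongr
  exact (ENat.add_le_add_iff_left hn2).mp h6

/-- Embed `F` into a multiple `u⁻¹ C`, which is its own bidual. Dualizing twice preserves `ℓ(u⁻¹ C /
F)`, so the inclusion of `F` into its bidual has length zero. -/
theorem div_div_self {F : Submodule R Q} (hF : IsLattice F) : C / (C / F) = F := by
  have hCC : C / (C / C) = C := by
    refine le_antisymm ?_ (le_div_div C C)
    have h := div_antitone C (Submodule.one_le.mpr (Submodule.one_mem_div.mpr (le_refl C)))
    rwa [div_one_eq] at h
  obtain ⟨x, hx, h⟩ := hF.exists_scale_le hC.toIsLattice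
  set u := toUnit Q hx
  have huC : C / (C / scale u⁻¹ C) = scale u⁻¹ C := by
    rw [div_scale, div_scale, inv_inv, hCC]
  have hle : F ≤ scale u⁻¹ C := by
    have := scale_mono u⁻¹ h
    rwa [scale_inv_scale] at this
  have hC' := hC.toIsLattice
  have hle' := div_antitone C (div_antitone C hle)
  have h1 := hC.relLength_div hF (hC'.scale u⁻¹) hle
  have h2 := hC.relLength_div (hC'.div (hC'.scale u⁻¹)) (hC'.div hF) (div_antitone C hle)
  rw [h1, huC] at h2
  rw [huC] at hle'
  have h3 := relLength_add (le_div_div C F) hle'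
  rw [h2] at h3
  have h4 : relLength F (C / (C / F)) = 0 := by
    have hne := hF.relLength_ne_top (hC'.scale u⁻¹)
    have : 0 + relLength F (scale u⁻¹ C) = relLength F (C / (C / F)) + relLength F (scale u⁻¹ C) := by
      rw [zero_add]; exact h3
    exact (ENat.add_left_injective_of_ne_top hne this).symm
  exact le_antisymm (relLength_eq_zero_iff.mp h4) (le_div_div C F)

theorem div_self : C / C = 1 := by
  have := hC.div_div_self (isLattice_one (R := R) (Q := Q))
  rwa [div_one_eq] at this

theorem div_lt_div {F G : Submodule R Q} (hF : IsLattice F) (hG : IsLattice G) (h : F < G) :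
    ∃ q ∈ C / F, q ∉ C / G := by
  by_contra! hc
  have h1 := div_antitone C (show C / F ≤ C / G from hc)
  rw [hC.div_div_self hF, hC.div_div_self hG] at h1
  exact absurd h1 (not_le_of_gt h)

/-- Canonical lattices are unique up to multiplication with a unit. -/
theorem eq_scale {C' : Submodule R Q} (hC' : IsCanonicalLattice C') :
    ∃ u : Qˣ, C' = scale u C := by
  -- With `D = C : C'`, both `D : D` and `C : (D C')` equal `C' : C' = R`; dualizing once more gives
  -- `D C' = C`.
  have key : ∀ {C C' : Submodule R Q}, IsCanonicalLattice C → IsCanonicalLattice C' →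
      (C / C') * C' = C := by
    intro C C' hC hC'
    have hD := hC.toIsLattice.div hC'.toIsLattice
    have hDD : (C / C') / (C / C') = 1 := by
      rw [← div_mul_eq, mul_comm, div_mul_eq, hC.div_div_self hC'.toIsLattice, hC'.div_self]
    rw [← hC.div_div_self (hD.mul hC'.toIsLattice), mul_comm, div_mul_eq, hDD, div_one_eq]
  have h1 := key hC hC'
  have h2 := key hC' hC
  set D := C / C'
  set D' := C' / C
  have hDDC : D * D' * C = C := by rw [mul_assoc, h2, h1]
  have hDD : D * D' ≤ 1 := by
    rw [← hC.div_self, Submodule.le_div_iff_mul_le, hDDC]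
  -- If no product `d d'` came from a unit of `R`, then `D D' ⊆ 𝔪` and `C = D D' C ⊆ 𝔪 C`, so `C =
  -- 0` by Nakayama. Otherwise `d'` is the required multiplier.
  have hex : ∃ d ∈ D, ∃ d' ∈ D', ∃ r : R, IsUnit r ∧ d * d' = algebraMap R Q r := by
    by_contra! hc
    have hle : D * D' ≤ Submodule.map (Algebra.linearMap R Q) (maximalIdeal R) := by
      rw [Submodule.mul_le]
      intro d hd d' hd'
      obtain ⟨r, hr⟩ := Submodule.mem_one.mp (hDD (Submodule.mul_mem_mul hd hd'))
      exact ⟨r, fun hu ↦ hc d hd d' hd' r hu hr.symm, hr⟩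
    have hCm : C ≤ (maximalIdeal R) • C := by
      conv_lhs => rw [← hDDC]
      rw [Submodule.mul_le]
      intro x hx c hc
      obtain ⟨r, hr, rfl⟩ := hle hx
      rw [Algebra.linearMap_apply, ← Algebra.smul_def]
      exact Submodule.smul_mem_smul hr hc
    have hfin := hC.toIsLattice.finite
    have hbot := Submodule.eq_bot_of_le_smul_of_le_jacobson_bot (maximalIdeal R) C
      (Module.Finite.iff_fg.mp hfin) hCm (IsLocalRing.maximalIdeal_le_jacobson _)
    obtain ⟨s, hs, -⟩ := hC.exists_socle
    obtain ⟨y, hy, hyC⟩ := hC.exists_mem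
    rw [hbot, Submodule.mem_bot] at hyC
    have := (isUnit_algebraMap (Q := Q) hy)
    rw [hyC, isUnit_zero_iff] at this
    have := subsingleton_of_zero_eq_one this
    exact hs (Subsingleton.elim 0 s ▸ C.zero_mem)
  obtain ⟨d, hd, d', hd', r, hr, hdd⟩ := hex
  have hunit : IsUnit (d * d') := hdd ▸ hr.map (algebraMap R Q)
  have hd'u : IsUnit d' := isUnit_of_mul_isUnit_right hunit
  refine ⟨hd'u.unit, le_antisymm (fun q hq ↦ ?_) fun q hq ↦ ?_⟩
  · obtain ⟨r, rfl⟩ := hr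
    refine mem_scale.mpr ⟨(↑r⁻¹ : R) • (d * q), C.smul_mem _ ?_, ?_⟩
    · rw [← h1]
      exact Submodule.mul_mem_mul hd hq
    · change d' * _ = q
      rw [mul_smul_comm, ← mul_assoc, mul_comm d' d, hdd, ← Algebra.smul_def, smul_smul,
        Units.inv_mul, one_smul]
  · obtain ⟨w, hw, rfl⟩ := mem_scale.mp hq
    rw [← h2]
    exact Submodule.mul_mem_mul hd' hw

theorem scale (u : Qˣ) : IsCanonicalLattice (scale u C) := by
  obtain ⟨s, hsC, hms, hs⟩ := hC.exists_socle
  refine ⟨hC.toIsLattice.scale u, u * s, fun h ↦ hsC (mul_mem_scale_iff.mp h), ?_, ?_⟩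
  · intro r hr
    rw [← mul_smul_comm]
    exact mul_mem_scale u (hms r hr)
  · intro q hq
    obtain ⟨q, rfl⟩ : ∃ q', q = u * q' := ⟨(↑u⁻¹ : Q) * q, by rw [Units.mul_inv_cancel_left]⟩
    obtain ⟨r, hr⟩ := hs q fun r hr ↦ by
      have := hq r hr
      rw [← mul_smul_comm] at this
      exact mul_mem_scale_iff.mp this
    refine ⟨r, ?_⟩
    rw [← mul_smul_comm, ← mul_sub]
    exact mul_mem_scale u hr

end IsCanonicalLattice

end Lattice

/-! ### Canonical ideals and canonical lattices -/

section CanonicalIdeal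

open IsLocalRing (maximalIdeal)

/-- Baer's criterion by enlarging the ideal on which `h` is multiplication by an element `e`. At a
socle step `g`, the discrepancy `h g - g • e` is a multiple of `e₀`. By `hann` some `e₁` killed by
the smaller ideal has `g • e₁` a unit multiple of `e₀`, so a multiple of `e₁` corrects `e`. -/
theorem baer_of_socle {B E : Type*} [CommRing B] [IsLocalRing B] [IsArtinianRing B]
    [AddCommGroup E] [Module B E] (e₀ : E)
    (he₀ : ∀ r ∈ maximalIdeal B, r • e₀ = 0)
    (hsoc : ∀ e : E, (∀ r ∈ maximalIdeal B, r • e = 0) → ∃ r : B, e = r • e₀)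
    (hann : ∀ N : Ideal B, ∀ g ∉ N, (∀ r ∈ maximalIdeal B, r * g ∈ N) →
      ∃ e : E, (∀ n ∈ N, n • e = 0) ∧ g • e ≠ 0) : Module.Baer B E := by
  intro N h
  suffices H : ∃ e : E, ∀ n (hn : n ∈ N), h ⟨n, hn⟩ = n • e by
    obtain ⟨e, he⟩ := H
    exact ⟨LinearMap.toSpanSingleton B E e, fun n hn ↦ (he n hn).symm⟩
  obtain ⟨N₀, ⟨hN₀, e, he⟩, hmax⟩ := set_has_maximal_iff_noetherian.mpr
    (inferInstanceAs (IsNoetherian B B))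
    {N₀ : Ideal B | N₀ ≤ N ∧ ∃ e : E, ∀ n (hn : n ∈ N), n ∈ N₀ → h ⟨n, hn⟩ = n • e}
    ⟨⊥, bot_le, 0, fun n hn hn' ↦ by
      obtain rfl : n = 0 := hn'
      rw [zero_smul]
      exact map_zero h⟩
  by_cases hNN : N ≤ N₀
  · exact ⟨e, fun n hn ↦ he n hn (hNN hn)⟩
  exfalso
  have hfin : relLength N₀ N ≠ ⊤ := Module.length_ne_top
  obtain ⟨g, hgN, hgN₀, hg⟩ := exists_smul_mem_of_relLength_ne_top hfin hNN
  have hk : ∀ r ∈ maximalIdeal B, r • (h ⟨g, hgN⟩ - g • e) = 0 := fun r hr ↦ by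
    have h1 := he (r * g) (N.mul_mem_left r hgN) (hg r hr)
    have h2 : h ⟨r * g, N.mul_mem_left r hgN⟩ = r • h ⟨g, hgN⟩ := by
      rw [← map_smul]
      rfl
    rw [smul_sub, ← h2, h1, mul_smul, sub_self]
  obtain ⟨t, ht⟩ := hsoc _ hk
  obtain ⟨e₁, he₁, hge₁⟩ := hann N₀ g hgN₀ hg
  obtain ⟨t₁, ht₁⟩ := hsoc (g • e₁) fun r hr ↦ by
    rw [← mul_smul]
    exact he₁ _ (hg r hr)
  have hunit : IsUnit t₁ := by
    by_contra hn
    exact hge₁ (by rw [ht₁, he₀ t₁ hn])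
  obtain ⟨t₁, rfl⟩ := hunit
  refine hmax (N₀ ⊔ Ideal.span {g}) ⟨sup_le hN₀ ((Ideal.span_singleton_le_iff_mem _).mpr hgN),
    e + (t * ↑t₁⁻¹ : B) • e₁, ?_⟩ ?_
  · intro n hn hn'
    obtain ⟨y, hy, z, hz, rfl⟩ := Submodule.mem_sup.mp hn'
    obtain ⟨r, rfl⟩ := Ideal.mem_span_singleton'.mp hz
    have h1 : h ⟨y + r * g, hn⟩ = h ⟨y, hN₀ hy⟩ + r • h ⟨g, hgN⟩ := by
      rw [← map_smul, ← map_add]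
      rfl
    have h2 : h ⟨g, hgN⟩ = g • (e + (t * ↑t₁⁻¹ : B) • e₁) := by
      rw [smul_add, smul_comm g, ht₁, smul_smul, mul_assoc, Units.inv_mul, mul_one, ← ht]
      abel
    have h3 : y • e = y • (e + (t * ↑t₁⁻¹ : B) • e₁) := by
      rw [smul_add, smul_comm y, he₁ y hy, smul_zero, add_zero]
    rw [h1, he _ _ hy, h2, h3, ← mul_smul, ← add_smul]
  · refine lt_of_le_of_ne le_sup_left fun heq ↦ hgN₀ ?_
    rw [heq]
    exact Ideal.mem_sup_right (Ideal.mem_span_singleton_self g)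

variable {A : Type u} [CommRing A]

theorem mk_eq_zero_iff_exists_mul (I : Ideal A) (x : A) (i : I) :
    (Submodule.Quotient.mk i : I ⧸ (Ideal.span {x} • (⊤ : Submodule A I))) = 0 ↔
      ∃ j ∈ I, (i : A) = x * j := by
  rw [Submodule.Quotient.mk_eq_zero, Submodule.ideal_span_singleton_smul,
    Submodule.mem_smul_pointwise_iff_exists]
  constructor
  · rintro ⟨j, -, rfl⟩
    exact ⟨j, j.2, rfl⟩
  · rintro ⟨j, hj, h⟩
    exact ⟨⟨j, hj⟩, trivial, Subtype.ext h.symm⟩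

variable {Q : Type*} [CommRing Q] [Algebra A Q]

/-- The image of an ideal in the total ring of fractions. -/
def ofIdeal (Q : Type*) [CommRing Q] [Algebra A Q] (I : Ideal A) : Submodule A Q :=
  Submodule.map (Algebra.linearMap A Q) I

theorem mem_ofIdeal {I : Ideal A} {q : Q} : q ∈ ofIdeal Q I ↔ ∃ i ∈ I, algebraMap A Q i = q :=
  Iff.rfl

variable [IsFractionRing A Q]

theorem algebraMap_mem_ofIdeal {I : Ideal A} {a : A} : algebraMap A Q a ∈ ofIdeal Q I ↔ a ∈ I := by
  rw [mem_ofIdeal]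
  constructor
  · rintro ⟨i, hi, h⟩
    rwa [← IsFractionRing.injective A Q h]
  · exact fun h ↦ ⟨a, h, rfl⟩

omit [IsFractionRing A Q] in
theorem isLattice_ofIdeal {I : Ideal A} {a : A} (ha : a ∈ A⁰) (haI : a ∈ I) :
    IsLattice (ofIdeal Q I) where
  exists_mem := ⟨a, ha, mem_ofIdeal.mpr ⟨a, haI, rfl⟩⟩
  exists_denominator := by
    refine ⟨1, one_mem _, ?_⟩
    rintro q ⟨i, -, rfl⟩
    exact ⟨i, by simp⟩

variable [IsCohenMacaulayLocalDimOne A]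

/-- Multiplication by `x ∈ 𝔪` identifies `(I : 𝔪) / I` with the socle of `I / xI`. Since the latter
is an essential extension of the residue field, its socle is the image of that field. -/
theorem IsCanonicalIdeal.isCanonicalLattice {I : Ideal A} (hI : IsCanonicalIdeal I) {a : A}
    (ha : a ∈ A⁰) (haI : a ∈ I) : IsCanonicalLattice (ofIdeal Q I) := by
  refine ⟨isLattice_ofIdeal ha haI, ?_⟩
  obtain ⟨-, -, x, hxm, hx, -, f, hf⟩ := hI
  obtain ⟨c, hc⟩ := Submodule.Quotient.mk_surjective _ (f 1)
  set ux := toUnit Q hx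
  have hux : (ux : Q) = algebraMap A Q x := rfl
  have hsmul : ∀ (r : A) (e : I ⧸ (Ideal.span {x} • (⊤ : Submodule A I))),
      Ideal.Quotient.mk (Ideal.span {x}) r • e = r • e := fun r e ↦ rfl
  have hf1 : ∀ r : A, f (Ideal.Quotient.mk _ (Ideal.Quotient.mk _ r)) =
      Submodule.Quotient.mk (r • c) := fun r ↦ by
    rw [Submodule.Quotient.mk_smul, hc, ← hsmul, ← map_smul]
    congr 1
    rw [Algebra.smul_def, mul_one]
    rfl
  have hc0 : ¬ ∃ j ∈ I, (c : A) = x * j := by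
    rw [← mk_eq_zero_iff_exists_mul, hc]
    intro h
    have h1 := hf.injective (h.trans (map_zero f).symm)
    obtain ⟨r, hr, hr1⟩ := (Ideal.mem_map_iff_of_surjective _ Ideal.Quotient.mk_surjective).mp
      ((Submodule.Quotient.mk_eq_zero _).mp h1)
    rw [← map_one (Ideal.Quotient.mk _), eq_comm, Ideal.Quotient.eq] at hr1
    have hx' := (Ideal.span_singleton_le_iff_mem _).mpr hxm hr1
    have := (maximalIdeal A).add_mem hx' hr
    rw [sub_add_cancel] at this
    exact (Ideal.ne_top_iff_one _).mp (IsLocalRing.maximalIdeal.isMaximal A).ne_top this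
  have hmc : ∀ r ∈ maximalIdeal A, ∃ j ∈ I, r * (c : A) = x * j := fun r hr ↦ by
    refine (mk_eq_zero_iff_exists_mul I x (r • c)).mp ?_
    rw [← hf1, Ideal.Quotient.eq_zero_iff_mem.mpr (Ideal.mem_map_of_mem _ hr), map_zero]
  -- The socle generator is `c / x`, where `c` lifts the image of `1` in the residue field.
  refine ⟨↑ux⁻¹ * algebraMap A Q c, ?_, ?_, ?_⟩
  · rintro ⟨j, hj, h⟩
    refine hc0 ⟨j, hj, IsFractionRing.injective A Q ?_⟩
    rw [map_mul, ← hux, ← Units.inv_mul_eq_iff_eq_mul]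
    exact h.symm
  · intro r hr
    obtain ⟨j, hj, h⟩ := hmc r hr
    refine mem_ofIdeal.mpr ⟨j, hj, ?_⟩
    rw [Algebra.smul_def, mul_left_comm, ← map_mul, h, map_mul, ← hux, Units.inv_mul_cancel_left]
  · intro q hq
    obtain ⟨i, hi, hiq⟩ := hq x hxm
    have hq' : q = ↑ux⁻¹ * algebraMap A Q i := by
      rw [Units.eq_inv_mul_iff_mul_eq, hux, ← Algebra.smul_def]
      exact hiq.symm
    by_cases h0 : ∃ j ∈ I, i = x * j
    · obtain ⟨j, hj, rfl⟩ := h0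
      refine ⟨0, mem_ofIdeal.mpr ⟨j, hj, ?_⟩⟩
      rw [hq', zero_smul, sub_zero, map_mul, ← hux, Units.inv_mul_cancel_left]
    set e : I ⧸ (Ideal.span {x} • (⊤ : Submodule A I)) := Submodule.Quotient.mk ⟨i, hi⟩
    have hme : ∀ r ∈ maximalIdeal A, r • e = 0 := fun r hr ↦ by
      refine (mk_eq_zero_iff_exists_mul I x (r • ⟨i, hi⟩)).mpr ?_
      obtain ⟨j, hj, h⟩ := hq r hr
      refine ⟨j, hj, IsFractionRing.injective A Q ?_⟩
      rw [map_mul, show algebraMap A Q j = r • q from h, hq', Algebra.smul_def, mul_left_comm,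
        ← hux, Units.mul_inv_cancel_left, ← map_mul]
      rfl
    -- By essentiality a non-zero multiple `t e` lies in the image of the residue field; `t` is a
    -- unit because `𝔪 e = 0`.
    have hne : Submodule.span (A ⧸ Ideal.span {x}) {e} ≠ ⊥ := by
      rw [Ne, Submodule.span_singleton_eq_bot]
      exact fun h ↦ h0 ((mk_eq_zero_iff_exists_mul I x ⟨i, hi⟩).mp h)
    obtain ⟨e', ⟨he', k, hk⟩, he0⟩ := Submodule.exists_mem_ne_zero_of_ne_bot
      (mt (hf.essential _) hne)
    obtain ⟨t, ht⟩ := Submodule.mem_span_singleton.mp he'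
    obtain ⟨t, rfl⟩ := Ideal.Quotient.mk_surjective t
    obtain ⟨k, rfl⟩ := Ideal.Quotient.mk_surjective k
    obtain ⟨k, rfl⟩ := Ideal.Quotient.mk_surjective k
    rw [hf1] at hk
    rw [hsmul] at ht
    have htu : IsUnit t := by
      by_contra htu
      exact he0 (by rw [← ht, hme t htu])
    obtain ⟨t, rfl⟩ := htu
    have h3 : (Submodule.Quotient.mk (⟨i, hi⟩ - (↑t⁻¹ * k : A) • c) :
        I ⧸ (Ideal.span {x} • (⊤ : Submodule A I))) = 0 := by
      rw [Submodule.Quotient.mk_sub, mul_smul, Submodule.Quotient.mk_smul, hk, ← ht, smul_smul,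
        Units.inv_mul, one_smul, sub_self]
    obtain ⟨j, hj, h4⟩ := (mk_eq_zero_iff_exists_mul I x _).mp h3
    refine ⟨↑t⁻¹ * k, mem_ofIdeal.mpr ⟨j, hj, ?_⟩⟩
    have h5 : i - (↑t⁻¹ * k : A) * c = x * j := h4
    rw [hq', Algebra.smul_def, mul_left_comm, ← mul_sub, ← map_mul, ← map_sub, h5, map_mul, ← hux,
      Units.inv_mul_cancel_left]

/-- For a regular `x ∈ 𝔪`, the socle of `I / xI` is generated by the class `e₀` of `x s`, with `s`
the socle generator of the lattice. Duality of lattices provides the separating elements needed for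
injectivity. Essentiality holds because `I / xI` has finite length, so every non-zero submodule
meets the socle. -/
theorem IsCanonicalLattice.isCanonicalIdeal {I : Ideal A} (hI : I ≠ ⊤)
    (hC : IsCanonicalLattice (ofIdeal Q I)) : IsCanonicalIdeal I := by
  obtain ⟨x, hxm, hx⟩ := IsCohenMacaulayLocalDimOne.exists_regular (A := A)
  set ux := toUnit Q hx
  have hux : (ux : Q) = algebraMap A Q x := rfl
  obtain ⟨s, hs, hms, hsoc⟩ := hC.exists_socle
  obtain ⟨c, hcI, hc⟩ := mem_ofIdeal.mp (hms x hxm)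
  have hc' : algebraMap A Q c = ux * s := by rw [hc, Algebra.smul_def, hux]
  let e₀ : I ⧸ (Ideal.span {x} • (⊤ : Submodule A I)) := Submodule.Quotient.mk ⟨c, hcI⟩
  have hsmul : ∀ (r : A) (e : I ⧸ (Ideal.span {x} • (⊤ : Submodule A I))),
      Ideal.Quotient.mk (Ideal.span {x}) r • e = r • e := fun r e ↦ rfl
  have hzero : ∀ (i : A) (hi : i ∈ I) (q : Q), algebraMap A Q i = ux * q →
      ((Submodule.Quotient.mk ⟨i, hi⟩ : I ⧸ (Ideal.span {x} • (⊤ : Submodule A I))) = 0 ↔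
        q ∈ ofIdeal Q I) := by
    intro i hi q hq
    rw [mk_eq_zero_iff_exists_mul, mem_ofIdeal]
    refine exists_congr fun j ↦ and_congr_right fun _ ↦ ?_
    rw [← ux.isUnit.mul_right_inj, ← hq, hux, ← map_mul, eq_comm,
      (IsFractionRing.injective A Q).eq_iff]
  have hme₀ : ∀ r ∈ maximalIdeal A, r • e₀ = 0 := fun r hr ↦ by
    refine (hzero (r * c) (I.mul_mem_left r hcI) (r • s) ?_).mpr (hms r hr)
    rw [map_mul, hc', mul_smul_comm, Algebra.smul_def]
  have he₀ : e₀ ≠ 0 := fun h ↦ hs ((hzero c hcI s hc').mp h)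
  have hE : ∀ e : I ⧸ (Ideal.span {x} • (⊤ : Submodule A I)),
      (∀ r ∈ maximalIdeal A, r • e = 0) → ∃ r : A, e = r • e₀ := by
    intro e he
    induction e using Submodule.Quotient.induction_on with
    | _ i =>
    have hi : algebraMap A Q i = ux * (↑ux⁻¹ * algebraMap A Q i) := by
      rw [Units.mul_inv_cancel_left]
    obtain ⟨r, hr⟩ := hsoc (↑ux⁻¹ * algebraMap A Q i) fun r hr ↦ by
      refine (hzero (r * i) (I.mul_mem_left r i.2) _ ?_).mp (he r hr)
      rw [mul_smul_comm, ← hi, map_mul, Algebra.smul_def]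
    refine ⟨r, ?_⟩
    rw [← sub_eq_zero]
    refine (hzero (i - r * c) (I.sub_mem i.2 (I.mul_mem_left r hcI)) _ ?_).mpr hr
    rw [mul_sub, ← hi, map_sub, map_mul, hc', mul_smul_comm, Algebra.smul_def]
  have hlt : Ideal.span {x} ≤ maximalIdeal A := (Ideal.span_singleton_le_iff_mem _).mpr hxm
  have hnt : Nontrivial (A ⧸ Ideal.span {x}) := Ideal.Quotient.nontrivial_iff.mpr
    (ne_top_of_le_ne_top (IsLocalRing.maximalIdeal.isMaximal A).ne_top hlt)
  have hloc : IsLocalRing (A ⧸ Ideal.span {x}) :=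
    IsLocalRing.of_surjective' _ Ideal.Quotient.mk_surjective
  have hmk : ∀ r ∈ maximalIdeal A,
      Ideal.Quotient.mk (Ideal.span {x}) r ∈ maximalIdeal (A ⧸ Ideal.span {x}) := by
    intro r hr hu
    obtain ⟨t, ht⟩ := isUnit_iff_exists_inv.mp hu
    obtain ⟨t, rfl⟩ := Ideal.Quotient.mk_surjective t
    rw [← map_mul, ← map_one (Ideal.Quotient.mk _), Ideal.Quotient.eq] at ht
    have := (maximalIdeal A).sub_mem ((maximalIdeal A).mul_mem_right t hr) (hlt ht)
    rw [sub_sub_cancel] at this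
    exact (Ideal.ne_top_iff_one _).mp (IsLocalRing.maximalIdeal.isMaximal A).ne_top this
  have hart : IsArtinianRing (A ⧸ Ideal.span {x}) := by
    have h1 : Module.length A (A ⧸ Ideal.span {x}) ≠ ⊤ := by
      refine length_ne_top_of_smul_eq_zero hx fun m ↦ ?_
      rw [Algebra.smul_def]
      change Ideal.Quotient.mk _ x * m = 0
      rw [Ideal.Quotient.eq_zero_iff_mem.mpr (Ideal.mem_span_singleton_self x), zero_mul]
    rw [Module.length_ne_top_iff, isFiniteLength_iff_isNoetherian_isArtinian] at h1
    have := h1.2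
    exact isArtinian_of_tower A this
  refine ⟨hI, inferInstance, x, hxm, hx, ?_, ?_⟩
  · intro y z hyz
    have h1 : x * y = x * z := congrArg Subtype.val hyz
    exact Subtype.ext ((mul_cancel_left_mem_nonZeroDivisors hx).mp h1)
  have hker : (maximalIdeal A).map (Ideal.Quotient.mk (Ideal.span {x})) ≤
      LinearMap.ker (LinearMap.toSpanSingleton (A ⧸ Ideal.span {x}) _ e₀) :=
    Ideal.map_le_iff_le_comap.mpr fun r hr ↦ hme₀ r hr
  refine ⟨Submodule.liftQ _ _ hker, ?_, ?_, ?_⟩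
  · rw [injective_iff_map_eq_zero]
    intro k hk
    obtain ⟨k, rfl⟩ := Submodule.Quotient.mk_surjective _ k
    obtain ⟨k, rfl⟩ := Ideal.Quotient.mk_surjective k
    have hk' : k • e₀ = 0 := hk
    refine (Submodule.Quotient.mk_eq_zero _).mpr (Ideal.mem_map_of_mem _ ?_)
    intro hu
    exact he₀ (hu.smul_eq_zero.mp hk')
  · refine Module.Baer.injective (baer_of_socle e₀ ?_ ?_ ?_)
    · intro r hr
      obtain ⟨r, rfl⟩ := Ideal.Quotient.mk_surjective r
      exact hme₀ r fun hu ↦ hr (hu.map _)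
    · intro e he
      obtain ⟨r, hr⟩ := hE e fun r hr ↦ he _ (hmk r hr)
      exact ⟨Ideal.Quotient.mk _ r, hr⟩
    · intro N g hg hgN
      obtain ⟨g, rfl⟩ := Ideal.Quotient.mk_surjective g
      set N' := N.comap (Ideal.Quotient.mk (Ideal.span {x}))
      have hxN : x ∈ N' := by
        change Ideal.Quotient.mk _ x ∈ N
        rw [Ideal.Quotient.eq_zero_iff_mem.mpr (Ideal.mem_span_singleton_self x)]
        exact N.zero_mem
      -- Strictness survives dualizing, giving `q` with `q N' ⊆ I` and `q g ∉ I`. As `x ∈ N'`, the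
      -- element `x q` lies in `I`; its class is killed by `N` but not by `g`.
      have hlt : ofIdeal Q N' < ofIdeal Q (N' ⊔ Ideal.span {g}) := by
        refine lt_of_le_of_ne (Submodule.map_mono le_sup_left) fun h ↦ hg ?_
        have : algebraMap A Q g ∈ ofIdeal Q (N' ⊔ Ideal.span {g}) :=
          algebraMap_mem_ofIdeal.mpr (Ideal.mem_sup_right (Ideal.mem_span_singleton_self g))
        rw [← h, algebraMap_mem_ofIdeal] at this
        exact this
      obtain ⟨q, hq, hq'⟩ := hC.div_lt_div (isLattice_ofIdeal hx hxN)
        (isLattice_ofIdeal hx (Ideal.mem_sup_left hxN)) hlt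
      rw [Submodule.mem_div_iff_forall_mul_mem] at hq
      have hN' : ∀ n ∈ N', n • q ∈ ofIdeal Q I := fun n hn ↦ by
        rw [Algebra.smul_def, mul_comm]
        exact hq _ (algebraMap_mem_ofIdeal.mpr hn)
      obtain ⟨i, hi, hiq⟩ := mem_ofIdeal.mp (hN' x hxN)
      have key : ∀ n : A, n • (Submodule.Quotient.mk ⟨i, hi⟩ :
          I ⧸ (Ideal.span {x} • (⊤ : Submodule A I))) = 0 ↔ n • q ∈ ofIdeal Q I := fun n ↦ by
        refine hzero (n * i) (I.mul_mem_left n hi) _ ?_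
        rw [map_mul, hiq, mul_smul_comm, Algebra.smul_def, Algebra.smul_def, hux]
      refine ⟨Submodule.Quotient.mk ⟨i, hi⟩, ?_, ?_⟩
      · intro n hn
        obtain ⟨n, rfl⟩ := Ideal.Quotient.mk_surjective n
        exact (key n).mpr (hN' n hn)
      · intro hge
        have hgq := (key g).mp hge
        refine hq' (Submodule.mem_div_iff_forall_mul_mem.mpr ?_)
        rintro _ ⟨y, hy, rfl⟩
        obtain ⟨n, hn, z, hz, rfl⟩ := Submodule.mem_sup.mp hy
        obtain ⟨r, rfl⟩ := Ideal.mem_span_singleton'.mp hz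
        rw [Algebra.linearMap_apply, mul_comm, ← Algebra.smul_def, add_smul, mul_smul]
        exact Submodule.add_mem _ (hN' n hn) (Submodule.smul_mem _ _ hgq)
  · intro P hP
    by_contra hne
    have hlen : relLength (⊥ : Submodule A (I ⧸ (Ideal.span {x} • (⊤ : Submodule A I))))
        (P.restrictScalars A) ≠ ⊤ := by
      refine ne_top_of_le_ne_top ?_ (relLength_mono_right bot_le le_top)
      rw [relLength_bot_top]
      refine length_ne_top_of_smul_eq_zero hx fun m ↦ ?_
      induction m using Submodule.Quotient.induction_on with
      | _ m => exact (mk_eq_zero_iff_exists_mul I x (x • m)).mpr ⟨m, m.2, rfl⟩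
    obtain ⟨e, heP, he0, hme⟩ := exists_smul_mem_of_relLength_ne_top hlen fun h ↦ hne <| by
      rw [eq_bot_iff]
      exact h
    obtain ⟨r, rfl⟩ := hE e hme
    have : r • e₀ ∈ P ⊓ LinearMap.range (Submodule.liftQ _ _ hker) :=
      ⟨heP, Submodule.Quotient.mk (Ideal.Quotient.mk _ r), rfl⟩
    rw [hP] at this
    exact he0 this

end CanonicalIdeal

/-! ### The Sally module -/

section SallyModule

open IsLocalRing (maximalIdeal)
open scoped TensorProduct

variable {A : Type u} [CommRing A]

/-- Coefficients of the submodule of `J𝓡` generated by its elements of degree at most one. -/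
def degreeOneCoeff (Q J : Ideal A) : ℕ → Ideal A
  | 0 => J
  | i + 1 => Q ^ i * J ^ 2

theorem pow_mul_degreeOneCoeff_le {Q J : Ideal A} (h : Q ≤ J) (j k : ℕ) :
    Q ^ j * degreeOneCoeff Q J k ≤ degreeOneCoeff Q J (j + k) := by
  cases k with
  | zero =>
    cases j with
    | zero => simp [degreeOneCoeff]
    | succ j =>
      change Q ^ (j + 1) * J ≤ Q ^ j * J ^ 2
      rw [pow_succ, mul_assoc, pow_two]
      exact mul_le_mul_right (mul_le_mul_left h _) _
  | succ k =>
    change Q ^ j * (Q ^ k * J ^ 2) ≤ Q ^ (j + k) * J ^ 2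
    rw [← mul_assoc, pow_add]

/-- The submodule of `A[t]` generated by the elements of degree at most one of `J𝓡`. -/
def degreeOnePart (Q J : Ideal A) (h : Q ≤ J) : Submodule (reesAlgebra Q) A[X] where
  carrier := {f | ∀ i, f.coeff i ∈ degreeOneCoeff Q J i}
  zero_mem' i := by simp
  add_mem' hf hg i := by
    rw [Polynomial.coeff_add]
    exact Ideal.add_mem _ (hf i) (hg i)
  smul_mem' g f hf i := by
    change ((g : A[X]) * f).coeff i ∈ _
    rw [Polynomial.coeff_mul]
    refine Ideal.sum_mem _ ?_
    rintro ⟨j, k⟩ e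
    rw [← Finset.HasAntidiagonal.mem_antidiagonal.mp e]
    exact pow_mul_degreeOneCoeff_le h j k (Ideal.mul_mem_mul (g.2 j) (hf k))

theorem mul_pow_le_degreeOneCoeff {Q J : Ideal A} (h : Q ≤ J) (i : ℕ) :
    J * Q ^ i ≤ degreeOneCoeff Q J i := by
  rw [mul_comm]
  exact pow_mul_degreeOneCoeff_le h i 0

theorem subquotient_mk_eq_mk_iff {B V : Type*} [CommRing B] [AddCommGroup V] [Module B V]
    {N P : Submodule B V} {x y : P} :
    (Submodule.Quotient.mk x : Subquotient P N) = Submodule.Quotient.mk y ↔ (x : V) - y ∈ N :=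
  Submodule.Quotient.eq _

/-- Every class has a representative in `degreeOnePart`. For `c t ^ 2` with `c ∈ J ^ 3`, comparing
coefficients of degree two gives `c ∈ Q J ^ 2 + J Q ^ 2 = Q J ^ 2`. -/
theorem pow_three_eq_of_generated {Q J : Ideal A} (h : Q ≤ J)
    (hS : SallyGeneratedInDegreeOne Q J h) : J ^ 3 = Q * J ^ 2 := by
  refine le_antisymm (fun c hc ↦ ?_) ?_
  · have hle : (⊤ : Submodule (reesAlgebra Q) (SallyModule Q J h)) ≤
        Submodule.map (Submodule.mkQ _) ((degreeOnePart Q J h).submoduleOf _) := by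
      rw [← hS, Submodule.span_le]
      rintro s ⟨f, ⟨c, hc⟩, rfl⟩
      refine ⟨f, (?_ : (f : A[X]) ∈ degreeOnePart Q J h), rfl⟩
      intro i
      have hf : (f : A[X]).coeff i ∈ J ^ (i + 1) := f.2 i
      rw [hc, Polynomial.coeff_monomial] at hf ⊢
      split_ifs at hf ⊢ with hi
      · subst hi
        simpa [degreeOneCoeff] using hf
      · exact zero_mem _
    have hcm : Polynomial.monomial 2 c ∈ idealMulRees Q J h := fun i ↦ by
      rw [Polynomial.coeff_monomial]
      split_ifs with hi
      · subst hi
        exact hc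
      · exact zero_mem _
    have hmem := hle (Submodule.mem_top (x := (Submodule.Quotient.mk ⟨_, hcm⟩ :
      SallyModule Q J h)))
    rw [Submodule.mem_map] at hmem
    obtain ⟨g, hg, hgc⟩ := hmem
    rw [Submodule.mkQ_apply] at hgc
    have hg' : (g : A[X]) ∈ degreeOnePart Q J h := hg
    have h1 := subquotient_mk_eq_mk_iff.mp hgc
    have h2 : ((g : A[X]) - Polynomial.monomial 2 c).coeff 2 ∈ J * Q ^ 2 := h1 2
    have h3 : (g : A[X]).coeff 2 ∈ degreeOneCoeff Q J 2 := hg' 2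
    have h4 := Ideal.sub_mem _ h3 (mul_pow_le_degreeOneCoeff h 2 h2)
    rw [Polynomial.coeff_sub, Polynomial.coeff_monomial, if_pos rfl, sub_sub_cancel] at h4
    simpa [degreeOneCoeff] using h4
  · exact (mul_le_mul_left h _).trans (pow_succ' J 2).ge

theorem pow_add_two_eq {Q J : Ideal A} (h3 : J ^ 3 = Q * J ^ 2) (i : ℕ) :
    J ^ (i + 2) = Q ^ i * J ^ 2 := by
  induction i with
  | zero => simp
  | succ i ih =>
    have h3' : J * J ^ 2 = Q * J ^ 2 := by rw [← pow_succ', h3]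
    rw [show i + 1 + 2 = (i + 2) + 1 by ring, pow_succ', ih, pow_succ Q, mul_left_comm, h3',
      mul_assoc]

/-! ### The Sally module of a principal ideal `Q = (a)`. -/

variable {J : Ideal A} {a : A} (h : Ideal.span {a} ≤ J)

theorem mem_span_pow_mul {I : Ideal A} {i : ℕ} {c : A} :
    c ∈ Ideal.span {a} ^ i * I ↔ ∃ d ∈ I, a ^ i * d = c := by
  rw [Ideal.span_singleton_pow, Ideal.mem_span_singleton_mul]

theorem monomial_mem_idealMulRees {i : ℕ} {c : A} (hc : c ∈ J ^ (i + 1)) :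
    Polynomial.monomial i c ∈ idealMulRees (Ideal.span {a}) J h := fun j ↦ by
  rw [Polynomial.coeff_monomial]
  split_ifs with hi
  · subst hi
    exact hc
  · exact zero_mem _

theorem monomial_mem_reesAlgebra (a : A) (i : ℕ) :
    Polynomial.monomial i (a ^ i) ∈ reesAlgebra (Ideal.span {a}) :=
  reesAlgebra.monomial_mem.mpr (Ideal.pow_mem_pow (Ideal.mem_span_singleton_self a) i)

/-- Since `J ^ (i + 2) = a ^ i J ^ 2`, a monomial of degree `i + 1` is `(a t) ^ i` times a monomial
`d t` with `d ∈ J ^ 2`; those of degree zero vanish in the quotient. -/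
theorem generated_of_pow_three_eq (h3 : J ^ 3 = Ideal.span {a} * J ^ 2) :
    SallyGeneratedInDegreeOne (Ideal.span {a}) J h := by
  rw [SallyGeneratedInDegreeOne, eq_top_iff]
  rintro s -
  induction s using Submodule.Quotient.induction_on with
  | _ f =>
  obtain ⟨f, hf⟩ := f
  set W := (Submodule.span (reesAlgebra (Ideal.span {a}))
    {s : SallyModule (Ideal.span {a}) J h | ∃ f : idealMulRees (Ideal.span {a}) J h,
      (∃ c : A, (f : A[X]) = Polynomial.monomial 1 c) ∧ Submodule.Quotient.mk f = s})
  have key : ∀ (i : ℕ) (c : A) (hc : c ∈ J ^ (i + 1)),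
      (Submodule.Quotient.mk ⟨_, monomial_mem_idealMulRees h hc⟩ :
        SallyModule (Ideal.span {a}) J h) ∈ W := by
    intro i c hc
    cases i with
    | zero =>
      convert W.zero_mem
      refine (Submodule.Quotient.mk_eq_zero _).mpr fun j ↦ ?_
      change (Polynomial.monomial 0 c).coeff j ∈ _
      rw [Polynomial.coeff_monomial]
      split_ifs with hj
      · subst hj
        simpa using hc
      · exact zero_mem _
    | succ i =>
      have hc' := hc
      rw [pow_add_two_eq h3, mem_span_pow_mul] at hc'
      obtain ⟨d, hd, rfl⟩ := hc'
      have h1 : (⟨_, monomial_mem_idealMulRees h hc⟩ : idealMulRees (Ideal.span {a}) J h) =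
          (⟨_, monomial_mem_reesAlgebra a i⟩ : reesAlgebra (Ideal.span {a})) •
            ⟨_, monomial_mem_idealMulRees h (i := 1) hd⟩ := by
        refine Subtype.ext ?_
        change _ = Polynomial.monomial i (a ^ i) * Polynomial.monomial 1 d
        rw [Polynomial.monomial_mul_monomial]
      rw [h1, Submodule.Quotient.mk_smul]
      exact W.smul_mem _ (Submodule.subset_span ⟨_, ⟨d, rfl⟩, rfl⟩)
  have hsum : (⟨f, hf⟩ : idealMulRees (Ideal.span {a}) J h) =
      ∑ i ∈ f.support, ⟨_, monomial_mem_idealMulRees h (hf i)⟩ := by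
    refine Subtype.ext ?_
    rw [AddSubmonoidClass.coe_finsetSum]
    exact f.as_sum_support
  rw [hsum, ← Submodule.mkQ_apply, map_sum]
  exact W.sum_mem fun i _ ↦ key i _ (hf i)

/-- For a non-zerodivisor `a`, the Rees algebra of `(a)` is a polynomial ring in `a t`. -/
def polynomialToRees (a : A) : A[X] →ₐ[A] reesAlgebra (Ideal.span {a}) :=
  Polynomial.aeval ⟨_, monomial_mem_reesAlgebra a 1⟩

theorem polynomialToRees_monomial (i : ℕ) (c : A) :
    (polynomialToRees a (Polynomial.monomial i c) : A[X]) = Polynomial.monomial i (c * a ^ i) := by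
  rw [polynomialToRees, Polynomial.aeval_monomial]
  change Polynomial.C c * (_ ^ i : reesAlgebra (Ideal.span {a})).1 = _
  rw [SubmonoidClass.coe_pow, Polynomial.monomial_pow, pow_one, one_mul,
    Polynomial.C_mul_monomial]

theorem coeff_polynomialToRees (f : A[X]) (i : ℕ) :
    (polynomialToRees a f : A[X]).coeff i = f.coeff i * a ^ i := by
  induction f using Polynomial.induction_on' with
  | add f g hf hg => rw [map_add, Polynomial.coeff_add, add_mul, ← hf, ← hg]; exact Polynomial.coeff_add _ _ _
  | monomial j c =>
    rw [polynomialToRees_monomial, Polynomial.coeff_monomial, Polynomial.coeff_monomial]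
    split_ifs with hij
    · rw [hij]
    · rw [zero_mul]

theorem bijective_polynomialToRees (ha : a ∈ A⁰) : Function.Bijective (polynomialToRees a) := by
  constructor
  · rw [injective_iff_map_eq_zero]
    intro f hf
    ext i
    have h1 := coeff_polynomialToRees (a := a) f i
    rw [hf] at h1
    exact (mul_right_mem_nonZeroDivisors_eq_zero_iff (pow_mem ha i)).mp h1.symm
  · rintro ⟨f, hf⟩
    have h1 : ∀ i, ∃ c, c * a ^ i = f.coeff i := fun i ↦ by
      have := hf i
      rwa [Ideal.span_singleton_pow, Ideal.mem_span_singleton'] at this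
    choose c hc using h1
    refine ⟨∑ i ∈ f.support, Polynomial.monomial i (c i), Subtype.ext ?_⟩
    rw [map_sum, AddSubmonoidClass.coe_finsetSum]
    refine Eq.trans ?_ f.as_sum_support.symm
    refine Finset.sum_congr rfl fun i _ ↦ ?_
    rw [polynomialToRees_monomial, hc]

def polynomialEquivRees (ha : a ∈ A⁰) : A[X] ≃ₐ[A] reesAlgebra (Ideal.span {a}) :=
  AlgEquiv.ofBijective _ (bijective_polynomialToRees ha)

theorem isPrime_map_maximalIdeal [IsLocalRing A] (ha : a ∈ A⁰) :
    ((maximalIdeal A).map (algebraMap A (reesAlgebra (Ideal.span {a})))).IsPrime := by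
  have h1 : (algebraMap A (reesAlgebra (Ideal.span {a}))) =
      ((polynomialEquivRees ha).toRingEquiv : A[X] →+* _).comp Polynomial.C := by
    ext r : 1
    exact ((polynomialEquivRees ha).commutes r).symm
  rw [h1, ← Ideal.map_map]
  have : ((maximalIdeal A).map (Polynomial.C : A →+* A[X])).IsPrime :=
    Ideal.isPrime_map_C_of_isPrime
  exact Ideal.map_isPrime_of_equiv (polynomialEquivRees ha).toRingEquiv

theorem flat_reesAlgebra (ha : a ∈ A⁰) : Module.Flat A (reesAlgebra (Ideal.span {a})) :=
  Module.Flat.of_linearEquiv (polynomialEquivRees ha).symm.toLinearEquiv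

/-- The degree one component of the Sally module. -/
def degreeOneToSally : Subquotient (J ^ 2) (Ideal.span {a} * J) →ₗ[A]
    SallyModule (Ideal.span {a}) J h :=
  Submodule.liftQ _
    { toFun := fun c ↦ Submodule.Quotient.mk ⟨_, monomial_mem_idealMulRees h (i := 1) c.2⟩
      map_add' := fun c d ↦ by
        rw [← Submodule.Quotient.mk_add]
        congr 1
        exact Subtype.ext (map_add (Polynomial.monomial 1) (c : A) (d : A))
      map_smul' := fun r c ↦ by
        rw [RingHom.id_apply, ← Submodule.Quotient.mk_smul]
        congr 1
        exact Subtype.ext (map_smul (Polynomial.monomial 1) r (c : A)) } (by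
      intro c hc
      refine (Submodule.Quotient.mk_eq_zero _).mpr fun j ↦ ?_
      change (Polynomial.monomial 1 (c : A)).coeff j ∈ _
      rw [Polynomial.coeff_monomial]
      split_ifs with hj
      · subst hj
        rw [pow_one, mul_comm]
        exact hc
      · exact zero_mem _)

/-- The base change of the degree one component to the Rees algebra. -/
def tensorToSally : reesAlgebra (Ideal.span {a}) ⊗[A] Subquotient (J ^ 2) (Ideal.span {a} * J)
    →ₗ[reesAlgebra (Ideal.span {a})] SallyModule (Ideal.span {a}) J h :=
  (degreeOneToSally h).liftBaseChange _

/-- This is the only place where generation in degree one enters the base change isomorphism. -/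
theorem surjective_tensorToSally (hS : SallyGeneratedInDegreeOne (Ideal.span {a}) J h) :
    Function.Surjective (tensorToSally h) := by
  rw [← LinearMap.range_eq_top, eq_top_iff, ← hS, Submodule.span_le]
  rintro s ⟨f, ⟨c, hc⟩, rfl⟩
  have hcJ : c ∈ J ^ 2 := by
    have := f.2 1
    rwa [hc, Polynomial.coeff_monomial, if_pos rfl] at this
  refine ⟨1 ⊗ₜ Submodule.Quotient.mk ⟨c, hcJ⟩, ?_⟩
  rw [tensorToSally, LinearMap.liftBaseChange_tmul, one_smul]
  change Submodule.Quotient.mk _ = Submodule.Quotient.mk _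
  congr 1
  exact Subtype.ext hc.symm

/-- The powers of `a t` form a basis of the Rees algebra, so a tensor is a finite family of `cᵢ ∈ J
^ 2`, mapping to the class of `∑ a ^ i cᵢ t ^ (i + 1)`. If this class vanishes then `a ^ i cᵢ ∈ a ^
(i + 1) J`, and cancelling `a ^ i` gives `cᵢ ∈ a J`. -/
theorem injective_tensorToSally (ha : a ∈ A⁰) : Function.Injective (tensorToSally h) := by
  let b : ℕ → reesAlgebra (Ideal.span {a}) := fun i ↦ ⟨_, monomial_mem_reesAlgebra a i⟩
  let Θ : (ℕ →₀ ↥(J ^ 2)) →+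
      reesAlgebra (Ideal.span {a}) ⊗[A] Subquotient (J ^ 2) (Ideal.span {a} * J) :=
    Finsupp.liftAddHom fun i ↦
      { toFun := fun c ↦ b i ⊗ₜ Submodule.Quotient.mk c
        map_zero' := by rw [Submodule.Quotient.mk_zero, TensorProduct.tmul_zero]
        map_add' := fun c d ↦ by rw [Submodule.Quotient.mk_add, TensorProduct.tmul_add] }
  have hΘ : ∀ i c, Θ (Finsupp.single i c) = b i ⊗ₜ Submodule.Quotient.mk c := fun i c ↦ by
    simp [Θ]
  have hsurj : ∀ z, ∃ c, Θ c = z := by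
    intro z
    induction z using TensorProduct.induction_on with
    | zero => exact ⟨0, map_zero _⟩
    | add x y hx hy =>
      obtain ⟨c, rfl⟩ := hx
      obtain ⟨d, rfl⟩ := hy
      exact ⟨c + d, map_add _ _ _⟩
    | tmul t n =>
      obtain ⟨f, rfl⟩ := (bijective_polynomialToRees ha).2 t
      obtain ⟨n, rfl⟩ := Submodule.Quotient.mk_surjective _ n
      induction f using Polynomial.induction_on' with
      | add f g hf hg =>
        obtain ⟨c, hc⟩ := hf
        obtain ⟨d, hd⟩ := hg
        exact ⟨c + d, by rw [map_add, map_add, hc, hd, TensorProduct.add_tmul]⟩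
      | monomial i r =>
        refine ⟨Finsupp.single i (r • n), ?_⟩
        rw [hΘ, Submodule.Quotient.mk_smul, ← TensorProduct.smul_tmul]
        congr 1
        refine Subtype.ext ?_
        rw [polynomialToRees_monomial]
        change r • Polynomial.monomial i (a ^ i) = _
        rw [Polynomial.smul_monomial, smul_eq_mul]
  let P : (ℕ →₀ ↥(J ^ 2)) → A[X] := fun c ↦
    c.sum fun i ci ↦ Polynomial.monomial (i + 1) (a ^ i * (ci : A))
  have hP : ∀ c, ∃ hc : P c ∈ idealMulRees (Ideal.span {a}) J h,
      tensorToSally h (Θ c) = Submodule.Quotient.mk ⟨P c, hc⟩ := by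
    intro c
    induction c using Finsupp.induction_linear with
    | zero => 
      have h0 : P 0 = 0 := Finsupp.sum_zero_index
      refine ⟨by rw [h0]; exact zero_mem _, ?_⟩
      rw [map_zero, map_zero, eq_comm]
      refine (Submodule.Quotient.mk_eq_zero _).mpr ?_
      change P 0 ∈ idealMulReesBase (Ideal.span {a}) J
      rw [h0]
      exact zero_mem _
    | add c d hc hd =>
      obtain ⟨hc, hc'⟩ := hc
      obtain ⟨hd, hd'⟩ := hd
      have h0 : P (c + d) = P c + P d :=
        Finsupp.sum_add_index' (by simp) (by intros; simp [mul_add])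
      refine ⟨by rw [h0]; exact add_mem hc hd, ?_⟩
      rw [map_add, map_add, hc', hd', ← Submodule.Quotient.mk_add]
      congr 1
      exact Subtype.ext h0.symm
    | single i c =>
      have h0 : P (Finsupp.single i c) = Polynomial.monomial (i + 1) (a ^ i * (c : A)) :=
        Finsupp.sum_single_index (by simp)
      have h1 : Polynomial.monomial (i + 1) (a ^ i * (c : A)) ∈
          idealMulRees (Ideal.span {a}) J h := by
        refine monomial_mem_idealMulRees h ?_
        rw [add_assoc, pow_add]
        exact Ideal.mul_mem_mul
          (Ideal.pow_mem_pow (h (Ideal.mem_span_singleton_self a)) i) c.2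
      refine ⟨by rw [h0]; exact h1, ?_⟩
      rw [hΘ, tensorToSally, LinearMap.liftBaseChange_tmul]
      change b i • Submodule.Quotient.mk _ = _
      rw [← Submodule.Quotient.mk_smul]
      congr 1
      refine Subtype.ext ?_
      change Polynomial.monomial i (a ^ i) * Polynomial.monomial 1 (c : A) = _
      rw [Polynomial.monomial_mul_monomial]
      exact h0.symm
  rw [injective_iff_map_eq_zero]
  intro z hz
  obtain ⟨c, rfl⟩ := hsurj z
  obtain ⟨hc, hc'⟩ := hP c
  rw [hc'] at hz
  have hbase : P c ∈ idealMulReesBase (Ideal.span {a}) J :=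
    (Submodule.Quotient.mk_eq_zero
      ((idealMulReesBase (Ideal.span {a}) J).submoduleOf (idealMulRees _ J h))).mp hz
  have hcoeff : ∀ i, (P c).coeff (i + 1) = a ^ i * (c i : A) := by
    intro i
    simp only [P, Finsupp.sum, Polynomial.finsetSum_coeff, Polynomial.coeff_monomial]
    by_cases hi : i ∈ c.support
    · rw [Finset.sum_eq_single i]
      · rw [if_pos rfl]
      · intro j _ hj
        rw [if_neg (by omega)]
      · exact fun hn ↦ absurd hi hn
    · rw [Finsupp.notMem_support_iff.mp hi, Finset.sum_eq_zero]
      · simp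
      · intro j hj
        rw [if_neg]
        rintro hji
        exact hi (by rwa [← Nat.succ_injective hji])
  have hmem : ∀ i, (c i : A) ∈ Ideal.span {a} * J := fun i ↦ by
    have h1 := hbase (i + 1)
    rw [hcoeff, mul_comm, mem_span_pow_mul] at h1
    obtain ⟨d, hd, h2⟩ := h1
    rw [pow_succ, mul_assoc] at h2
    rw [← (mul_cancel_left_mem_nonZeroDivisors (pow_mem ha i)).mp h2]
    exact Ideal.mul_mem_mul (Ideal.mem_span_singleton_self a) hd
  rw [← Finsupp.sum_single c, Finsupp.sum, map_sum]
  refine Finset.sum_eq_zero fun i _ ↦ ?_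
  rw [hΘ, (Submodule.Quotient.mk_eq_zero
    ((Ideal.span {a} * J).submoduleOf (J ^ 2))).mpr (hmem i), TensorProduct.tmul_zero]

/-- `A → T_𝔭` is a flat local homomorphism with `𝔪 T_𝔭` the maximal ideal, so base change multiplies
lengths by `ℓ(T_𝔭 / 𝔪 T_𝔭) = 1`. -/
theorem length_localizedModule_tensorProduct [IsLocalRing A] {T : Type u} [CommRing T]
    [Algebra A T] [Module.Flat A T] (p : Ideal T) [p.IsPrime]
    (hp : p = (maximalIdeal A).map (algebraMap A T)) {M N : Type u} [AddCommGroup M] [Module T M]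
    [AddCommGroup N] [Module A N] (e : T ⊗[A] N ≃ₗ[T] M) :
    Module.length (Localization.AtPrime p) (LocalizedModule p.primeCompl M) =
      Module.length A N := by
  have hmap : (maximalIdeal A).map (algebraMap A (Localization.AtPrime p)) =
      maximalIdeal (Localization.AtPrime p) := by
    rw [IsScalarTower.algebraMap_eq A T, ← Ideal.map_map, ← hp,
      Localization.AtPrime.map_eq_maximalIdeal]
  have : IsLocalHom (algebraMap A (Localization.AtPrime p)) :=
    ((IsLocalRing.local_hom_TFAE _).out 0 2).mpr hmap.le
  have : Module.Flat T (Localization.AtPrime p) := IsLocalization.flat _ p.primeCompl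
  have : Module.Flat A (Localization.AtPrime p) := Module.Flat.trans A T _
  let e' : LocalizedModule p.primeCompl M ≃ₗ[Localization.AtPrime p]
      Localization.AtPrime p ⊗[A] N :=
    (LocalizedModule.equivTensorProduct p.primeCompl M).trans
      ((TensorProduct.AlgebraTensorModule.congr (LinearEquiv.refl _ _) e.symm).trans
        (TensorProduct.AlgebraTensorModule.cancelBaseChange A T _ _ N))
  have : IsSimpleModule (Localization.AtPrime p)
      (Localization.AtPrime p ⧸ maximalIdeal (Localization.AtPrime p)) :=
    isSimpleModule_iff_quot_maximal.mpr ⟨_, IsLocalRing.maximalIdeal.isMaximal _, ⟨LinearEquiv.refl _ _⟩⟩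
  rw [e'.length_eq, IsLocalRing.length_baseChange, hmap, Module.length_eq_one_iff.mpr this, mul_one]

theorem sallyHasRank_iff [IsLocalRing A] (ha : a ∈ A⁰)
    (hS : SallyGeneratedInDegreeOne (Ideal.span {a}) J h) (n : ℕ) :
    SallyHasRank (Ideal.span {a}) J h n ↔ relLength (Ideal.span {a} * J) (J ^ 2) = n := by
  have hprime := isPrime_map_maximalIdeal ha
  have := flat_reesAlgebra ha
  rw [SallyHasRank, exists_prop_of_true hprime, length_localizedModule_tensorProduct _ rfl
    (LinearEquiv.ofBijective _ ⟨injective_tensorToSally h ha, surjective_tensorToSally h hS⟩)]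
  rfl

end SallyModule

/-! ### Goto rings in terms of canonical lattices -/

section Goto

open IsLocalRing (maximalIdeal)

variable {A : Type u} [CommRing A] {Q : Type*} [CommRing Q] [Algebra A Q]

theorem pow_eq_of_pow_succ_eq {M : Type*} [Monoid M] {C : M} {r : ℕ} (h : C ^ (r + 1) = C ^ r)
    {k : ℕ} (hk : r ≤ k) : C ^ k = C ^ r := by
  induction k, hk using Nat.le_induction with
  | base => rfl
  | succ k _ ih => rw [pow_succ, ih, ← pow_succ, h]

theorem ofIdeal_mul (I J : Ideal A) : ofIdeal Q (I * J) = ofIdeal Q I * ofIdeal Q J := by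
  refine le_antisymm ?_ ?_
  · rw [ofIdeal, Submodule.map_le_iff_le_comap]
    refine Ideal.mul_le.mpr fun i hi j hj ↦ ?_
    rw [Submodule.mem_comap, Algebra.linearMap_apply, map_mul]
    exact Submodule.mul_mem_mul ⟨i, hi, rfl⟩ ⟨j, hj, rfl⟩
  · rw [Submodule.mul_le]
    rintro _ ⟨i, hi, rfl⟩ _ ⟨j, hj, rfl⟩
    exact ⟨i * j, Ideal.mul_mem_mul hi hj, map_mul (algebraMap A Q) i j⟩

theorem ofIdeal_pow (I : Ideal A) (n : ℕ) : ofIdeal Q (I ^ (n + 1)) = ofIdeal Q I ^ (n + 1) := by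
  induction n with
  | zero => simp
  | succ n ih => rw [pow_succ, ofIdeal_mul, ih, ← pow_succ]

variable [IsFractionRing A Q]

theorem ofIdeal_injective : Function.Injective (ofIdeal (A := A) Q) :=
  Submodule.map_injective_of_injective (IsFractionRing.injective A Q)

theorem relLength_ofIdeal (I J : Ideal A) :
    relLength (ofIdeal Q I) (ofIdeal Q J) = relLength I J := by
  refine (relLength_eq_of_addHom (σ := RingHom.id A) (algebraMap A Q).toAddMonoidHom
    ?_ ?_ ?_ ?_).symm
  · exact fun x hx ↦ ⟨x, hx, rfl⟩
  · rintro _ ⟨x, hx, rfl⟩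
    exact ⟨x, hx, by simp⟩
  · exact fun x _ ↦ algebraMap_mem_ofIdeal
  · intro r x _
    simp [Algebra.smul_def]

theorem ofIdeal_span_mul {a : A} (ha : a ∈ A⁰) (I : Ideal A) :
    ofIdeal Q (Ideal.span {a} * I) = scale (toUnit Q ha) (ofIdeal Q I) := by
  rw [ofIdeal_mul, scale]
  congr 1
  rw [ofIdeal, Ideal.span, Submodule.map_span, Set.image_singleton]
  rfl

section Power

variable {a : A} (ha : a ∈ A⁰) (I : Ideal A)

theorem pow_three_eq_iff : I ^ 3 = Ideal.span {a} * I ^ 2 ↔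
    scale (toUnit Q ha)⁻¹ (ofIdeal Q I) ^ 3 = scale (toUnit Q ha)⁻¹ (ofIdeal Q I) ^ 2 := by
  rw [← (ofIdeal_injective (A := A) (Q := Q)).eq_iff, ofIdeal_span_mul ha, ofIdeal_pow, ofIdeal_pow,
    scale_pow, scale_pow]
  set u := toUnit Q ha
  constructor
  · intro h
    rw [h, scale_scale]
    congr 1
    group
  · intro h
    have h1 := congrArg (scale (u ^ 3)) h
    rw [scale_scale, scale_scale] at h1
    have e1 : u ^ 3 * u⁻¹ ^ 3 = 1 := by group
    have e2 : u ^ 3 * u⁻¹ ^ 2 = u := by group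
    rwa [e1, e2, scale_one] at h1

theorem relLength_scale_ofIdeal :
    relLength (scale (toUnit Q ha)⁻¹ (ofIdeal Q I)) (scale (toUnit Q ha)⁻¹ (ofIdeal Q I) ^ 2) =
      relLength (Ideal.span {a} * I) (I ^ 2) := by
  have e : (toUnit Q ha)⁻¹ ^ 2 * toUnit Q ha = (toUnit Q ha)⁻¹ := by group
  have h := relLength_scale ((toUnit Q ha)⁻¹ ^ 2) (scale (toUnit Q ha) (ofIdeal Q I))
    (ofIdeal Q I ^ 2)
  rw [scale_scale, e] at h
  rw [scale_pow, h, ← relLength_ofIdeal (Q := Q), ofIdeal_span_mul ha, ofIdeal_pow]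

end Power

variable [IsCohenMacaulayLocalDimOne A]

/-- A power of a regular element of `𝔪` is a multiple of `a`. -/
theorem IsParameter.mem_nonZeroDivisors {a : A} (ha : IsParameter a) : a ∈ A⁰ := by
  obtain ⟨x, hxm, hx⟩ := IsCohenMacaulayLocalDimOne.exists_regular (A := A)
  rw [← ha] at hxm
  obtain ⟨n, hn⟩ := hxm
  obtain ⟨r, hr⟩ := Ideal.mem_span_singleton'.mp hn
  have h1 : r * a ∈ A⁰ := hr ▸ pow_mem hx n
  exact (mul_mem_nonZeroDivisors.mp h1).2

omit [IsCohenMacaulayLocalDimOne A] in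
-- The powers of `r` stabilize modulo `b`: `r ^ n ≡ r ^ (n + 1) t`, and `1 - r t` is a unit.
theorem exists_pow_mem_span_of_isArtinian [IsLocalRing A] {b r : A}
    [IsArtinian A (A ⧸ Ideal.span {b})] (hr : r ∈ maximalIdeal A) :
    ∃ n, r ^ n ∈ Ideal.span {b} := by
  obtain ⟨n, y, hy⟩ := IsArtinian.exists_pow_succ_smul_dvd r (1 : A ⧸ Ideal.span {b})
  obtain ⟨t, rfl⟩ := Ideal.Quotient.mk_surjective y
  have h2 : Ideal.Quotient.mk (Ideal.span {b}) (r ^ (n + 1) * t) =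
      Ideal.Quotient.mk (Ideal.span {b}) (r ^ n * 1) := hy
  rw [eq_comm, Ideal.Quotient.eq] at h2
  have hu : IsUnit (1 - r * t) := by
    by_contra hn
    have := (maximalIdeal A).add_mem hn ((maximalIdeal A).mul_mem_right t hr)
    rw [sub_add_cancel] at this
    exact (Ideal.ne_top_iff_one _).mp (IsLocalRing.maximalIdeal.isMaximal A).ne_top this
  refine ⟨n, (Ideal.mul_unit_mem_iff_mem _ hu).mp ?_⟩
  have e : r ^ n * (1 - r * t) = r ^ n * 1 - r ^ (n + 1) * t := by ring
  rwa [e]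

theorem exists_pow_mem_span {b r : A} (hb : b ∈ A⁰) (hr : r ∈ maximalIdeal A) :
    ∃ n, r ^ n ∈ Ideal.span {b} := by
  have h1 : Module.length A (A ⧸ Ideal.span {b}) ≠ ⊤ := by
    refine length_ne_top_of_smul_eq_zero hb fun m ↦ ?_
    rw [Algebra.smul_def]
    change Ideal.Quotient.mk _ b * m = 0
    rw [Ideal.Quotient.eq_zero_iff_mem.mpr (Ideal.mem_span_singleton_self b), zero_mul]
  rw [Module.length_ne_top_iff, isFiniteLength_iff_isNoetherian_isArtinian] at h1
  have := h1.2
  exact exists_pow_mem_span_of_isArtinian hr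

theorem isParameter_of_mem {b : A} (hb : b ∈ A⁰) (hbm : b ∈ maximalIdeal A) : IsParameter b := by
  refine le_antisymm ?_ fun r hr ↦ exists_pow_mem_span hb hr
  exact (IsLocalRing.maximalIdeal.isMaximal A).isPrime.radical_le_iff.mpr
    ((Ideal.span_singleton_le_iff_mem _).mpr hbm)

theorem sally_iff {I : Ideal A} {a : A} (ha : a ∈ A⁰) (haI : a ∈ I) (n : ℕ) :
    (SallyHasRank (Ideal.span {a}) (I ⊔ Ideal.span {a}) le_sup_right n ∧
      SallyGeneratedInDegreeOne (Ideal.span {a}) (I ⊔ Ideal.span {a}) le_sup_right) ↔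
    (scale (toUnit Q ha)⁻¹ (ofIdeal Q I) ^ 3 = scale (toUnit Q ha)⁻¹ (ofIdeal Q I) ^ 2 ∧
      relLength (scale (toUnit Q ha)⁻¹ (ofIdeal Q I))
        (scale (toUnit Q ha)⁻¹ (ofIdeal Q I) ^ 2) = n) := by
  have hsup : I ⊔ Ideal.span {a} = I :=
    sup_eq_left.mpr ((Ideal.span_singleton_le_iff_mem _).mpr haI)
  rw [relLength_scale_ofIdeal, ← pow_three_eq_iff]
  have hgen : SallyGeneratedInDegreeOne (Ideal.span {a}) (I ⊔ Ideal.span {a}) le_sup_right ↔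
      I ^ 3 = Ideal.span {a} * I ^ 2 := by
    refine ⟨fun h ↦ ?_, fun h ↦ generated_of_pow_three_eq _ (by rw [hsup, h])⟩
    have := pow_three_eq_of_generated _ h
    rwa [hsup] at this
  rw [← hgen, and_comm]
  refine and_congr_right fun h ↦ ?_
  rw [sallyHasRank_iff le_sup_right ha h, hsup]

variable (Q) in
-- From an ideal take `C = I / a`. Conversely choose a regular `b` with `b C ⊆ 𝔪` and put `I = b C`;
-- then `1 ∈ C` says `b ∈ I`, so `b` is a parameter.
theorem isGoto_iff_exists (n : ℕ) : IsGoto n A ↔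
    ∃ C : Submodule A Q, IsCanonicalLattice C ∧ 1 ∈ C ∧ C ^ 3 = C ^ 2 ∧
      relLength C (C ^ 2) = n := by
  constructor
  · rintro ⟨_, I, hI, a, ha, haI, hS⟩
    have ha' := ha.mem_nonZeroDivisors
    obtain ⟨h1, h2⟩ := (sally_iff (Q := Q) ha' haI n).mp hS
    refine ⟨_, (hI.isCanonicalLattice ha' haI).scale _, ?_, h1, h2⟩
    refine mem_scale.mpr ⟨algebraMap A Q a, algebraMap_mem_ofIdeal.mpr haI, ?_⟩
    rw [← coe_toUnit ha', Units.inv_mul]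
  · rintro ⟨C, hC, h1, h3, hn⟩
    obtain ⟨x, hxm, hx⟩ := IsCohenMacaulayLocalDimOne.exists_regular (A := A)
    obtain ⟨b, hb, hle⟩ := hC.toIsLattice.exists_scale_le (isLattice_ofIdeal (Q := Q) hx hxm)
    let I : Ideal A := Submodule.comap (Algebra.linearMap A Q) (scale (toUnit Q hb) C)
    have hI : ofIdeal Q I = scale (toUnit Q hb) C := by
      refine le_antisymm (Submodule.map_comap_le _ _) fun q hq ↦ ?_
      obtain ⟨i, -, rfl⟩ := hle hq
      exact ⟨i, hq, rfl⟩
    have hIm : I ≤ maximalIdeal A := fun i hi ↦ by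
      have h := hle (x := algebraMap A Q i) hi
      rwa [algebraMap_mem_ofIdeal] at h
    have hbI : b ∈ I := mem_scale.mpr ⟨1, h1, by rw [mul_one]; rfl⟩
    have hCI : scale (toUnit Q hb)⁻¹ (ofIdeal Q I) = C := by rw [hI, scale_inv_scale]
    refine ⟨inferInstance, I, IsCanonicalLattice.isCanonicalIdeal (Q := Q) ?_ ?_, b,
      isParameter_of_mem hb (hIm hbI), hbI, (sally_iff (Q := Q) hb hbI n).mpr ?_⟩
    · exact ne_top_of_le_ne_top (IsLocalRing.maximalIdeal.isMaximal A).ne_top hIm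
    · rw [hI]
      exact hC.scale _
    · rw [hCI]
      exact ⟨h3, hn⟩

/-- The `n`-Goto property can be tested on any canonical lattice between `A` and its integral
closure. -/
theorem isGoto_iff_of_isCanonicalLattice {C : Submodule A Q} (hC : IsCanonicalLattice C)
    (h1 : 1 ∈ C) {r : ℕ} (hr : C ^ (r + 1) = C ^ r) (n : ℕ) :
    IsGoto n A ↔ C ^ 3 = C ^ 2 ∧ relLength C (C ^ 2) = n := by
  rw [isGoto_iff_exists Q]
  refine ⟨?_, fun h ↦ ⟨C, hC, h1, h⟩⟩
  rintro ⟨C', hC', h1', h3', hn'⟩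
  obtain ⟨u, rfl⟩ := hC.eq_scale hC'
  -- Large enough for the powers of both `C` and `u C` to be stationary from exponent `N` on.
  set N := r + 2
  have e1 : C ^ (N + 1) = C ^ N := by
    rw [pow_eq_of_pow_succ_eq hr (by omega : r ≤ N + 1),
      pow_eq_of_pow_succ_eq hr (by omega : r ≤ N)]
  have e2 : scale (u ^ N) (C ^ N) = scale u C ^ 2 := by
    rw [← scale_pow, pow_eq_of_pow_succ_eq h3' (by omega : 2 ≤ N)]
  have e3 : scale (u ^ (N + 1)) (C ^ N) = scale u C ^ 2 := by
    rw [← e1, ← scale_pow, pow_eq_of_pow_succ_eq h3' (by omega : 2 ≤ N + 1)]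
  -- Both `u ^ N C ^ N` and `u ^ (N + 1) C ^ N` equal the stable power `(u C) ^ 2`. So `u` preserves
  -- `C ^ N`, and the factor `u` drops out of all later comparisons.
  have e4 : scale u (C ^ N) = C ^ N := by
    have := congrArg (scale (u ^ N)⁻¹) (e3.trans e2.symm)
    rwa [scale_scale, scale_inv_scale, pow_succ u N, inv_mul_cancel_left] at this
  have e5 : ∀ k : ℕ, scale (u ^ k) (C ^ N) = C ^ N := by
    intro k
    induction k with
    | zero => rw [pow_zero, scale_one]
    | succ k ih => rw [pow_succ, ← scale_scale, e4, ih]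
  rw [e5] at e2
  have e6 : C ^ 2 = C ^ N := by
    have h2 := congrArg (scale (u ^ 2)⁻¹) e2
    have h3 := congrArg (scale (u ^ 2)⁻¹) (e5 2)
    rw [scale_inv_scale] at h3
    rw [scale_pow, scale_inv_scale] at h2
    rw [← h2, ← h3]
  refine ⟨by rw [pow_succ, e6, ← pow_succ, e1], ?_⟩
  rw [e6, ← relLength_scale u, e4, e2, hn']

end Goto

/-! ### Quasi-trivial extensions -/

section Extension

open IsLocalRing (maximalIdeal)

theorem IsCohenMacaulayLocalDimOne.of_ringEquiv {A A' : Type*} [CommRing A] [CommRing A']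
    (e : A ≃+* A') [IsCohenMacaulayLocalDimOne A'] : IsCohenMacaulayLocalDimOne A := by
  have hloc : IsLocalRing A := e.symm.isLocalRing
  have hnoeth : IsNoetherianRing A := isNoetherianRing_of_ringEquiv A' e.symm
  refine { krullDim_eq := ?_, exists_regular := ?_ }
  · rw [ringKrullDim_eq_of_ringEquiv e, IsCohenMacaulayLocalDimOne.krullDim_eq (A := A')]
  · obtain ⟨x, hxm, hx⟩ := IsCohenMacaulayLocalDimOne.exists_regular (A := A')
    refine ⟨e.symm x, fun hu ↦ hxm ?_, ?_⟩
    · have := hu.map e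
      rwa [e.apply_symm_apply] at this
    · rw [mem_nonZeroDivisors_iff_right] at hx ⊢
      intro z hz
      have h1 := hx (e z) (by
        have := congrArg e hz
        rwa [map_mul, e.apply_symm_apply, map_zero] at this)
      exact (map_eq_zero_iff e e.injective).mp h1

variable {R : Type*} [CommRing R] {J : Ideal R} {α : R}

theorem quasiTrivialExtension_ext {z w : quasiTrivialExtension J α} (h₁ : z.1.re = w.1.re)
    (h₂ : z.1.im = w.1.im) : z = w :=
  Subtype.ext (QuadraticAlgebra.ext h₁ h₂)

/-- The projection `R ⋉ J → R`. -/
def reHom (J : Ideal R) (α : R) : quasiTrivialExtension J α →+* R where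
  toFun z := z.1.re
  map_one' := rfl
  map_mul' z w := by simp
  map_zero' := rfl
  map_add' _ _ := rfl

/-- The inclusion `R → R ⋉ J`. -/
def inclHom (J : Ideal R) (α : R) : R →+* quasiTrivialExtension J α where
  toFun r := ⟨⟨r, 0⟩, J.zero_mem⟩
  map_one' := rfl
  map_mul' r s := quasiTrivialExtension_ext (by simp) (by simp)
  map_zero' := rfl
  map_add' r s := quasiTrivialExtension_ext (by simp) (by simp)

/-- The norm of `a + x ω` is `a (a + α x)`, and `a + α x` is a unit along with `a` because `x ∈ 𝔪`.
Thus the maximal ideal of the extension is `𝔪 × J`. -/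
theorem isUnit_quasiTrivialExtension [IsLocalRing R] (hJ : J ≤ maximalIdeal R)
    {z : quasiTrivialExtension J α} (hz : IsUnit z.1.re) : IsUnit z := by
  have hz2 : IsUnit (z.1.re + α * z.1.im) := by
    by_contra hn
    have h1 := (maximalIdeal R).sub_mem hn ((maximalIdeal R).mul_mem_left α (hJ z.2))
    rw [add_sub_cancel_right] at h1
    exact h1 hz
  obtain ⟨u, hu⟩ := isUnit_iff_exists_inv.mp hz
  obtain ⟨v, hv⟩ := isUnit_iff_exists_inv.mp hz2
  refine isUnit_iff_exists_inv.mpr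
    ⟨⟨⟨u, -(u * v) * z.1.im⟩, J.mul_mem_left _ z.2⟩, quasiTrivialExtension_ext ?_ ?_⟩
  · simpa [QuadraticAlgebra.re_one] using hu
  · simp only [Subring.coe_mul, QuadraticAlgebra.im_mul, Subring.coe_one, QuadraticAlgebra.im_one]
    linear_combination (-(u * z.1.im)) * hv

/-- The extension is finite over `R`, hence Noetherian. The image `Y` of `y` is regular with
Artinian quotient, so the maximal ideal is minimal over `(Y)`: its height is at most one by Krull,
and at least one since `Y` is regular. -/
theorem isCohenMacaulayLocalDimOne_quasiTrivialExtension [IsCohenMacaulayLocalDimOne R]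
    (hJ : J ≤ maximalIdeal R) {y : R} (hy : y ∈ R⁰) (hyJ : y ∈ J) :
    IsCohenMacaulayLocalDimOne (quasiTrivialExtension J α) := by
  have hlh : IsLocalHom (reHom J α) := ⟨fun z hz ↦ isUnit_quasiTrivialExtension hJ hz⟩
  have hloc : IsLocalRing (quasiTrivialExtension J α) := RingHom.domain_isLocalRing (reHom J α)
  let _ : Algebra R (quasiTrivialExtension J α) := (inclHom J α).toAlgebra
  let p : R × J →ₗ[R] quasiTrivialExtension J α :=
    { toFun := fun x ↦ ⟨⟨x.1, x.2⟩, x.2.2⟩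
      map_add' := fun x y ↦ rfl
      map_smul' := fun r x ↦ by
        rw [Algebra.smul_def]
        refine quasiTrivialExtension_ext ?_ ?_
        · change r * x.1 = (inclHom J α r * _ : quasiTrivialExtension J α).1.re
          simp [inclHom]
        · change r * x.2 = (inclHom J α r * _ : quasiTrivialExtension J α).1.im
          simp [inclHom] }
  have hp : Function.Surjective p := fun z ↦ ⟨(z.1.re, ⟨z.1.im, z.2⟩), rfl⟩
  have hfin : Module.Finite R (quasiTrivialExtension J α) := Module.Finite.of_surjective p hp
  have hnoeth : IsNoetherianRing (quasiTrivialExtension J α) :=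
    IsNoetherianRing.of_finite R (quasiTrivialExtension J α)
  set Y := inclHom J α y
  have hYm : Y ∈ maximalIdeal (quasiTrivialExtension J α) := fun hu ↦
    hJ hyJ (hu.map (reHom J α))
  have hY : Y ∈ (quasiTrivialExtension J α)⁰ := by
    rw [mem_nonZeroDivisors_iff_right] at hy ⊢
    intro z hz
    refine quasiTrivialExtension_ext (hy _ ?_) (hy _ ?_)
    · simpa [Y, inclHom] using congrArg (fun z : quasiTrivialExtension J α ↦ z.1.re) hz
    · simpa [Y, inclHom] using congrArg (fun z : quasiTrivialExtension J α ↦ z.1.im) hz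
  have hart : IsArtinian (quasiTrivialExtension J α)
      (quasiTrivialExtension J α ⧸ Ideal.span {Y}) := by
    have h1 : Module.length R (quasiTrivialExtension J α ⧸ Ideal.span {Y}) ≠ ⊤ := by
      refine length_ne_top_of_smul_eq_zero hy fun m ↦ ?_
      obtain ⟨m, rfl⟩ := Ideal.Quotient.mk_surjective m
      change Ideal.Quotient.mk _ (y • m) = 0
      rw [Algebra.smul_def]
      exact Ideal.Quotient.eq_zero_iff_mem.mpr
        (Ideal.mul_mem_right _ _ (Ideal.mem_span_singleton_self Y))
    rw [Module.length_ne_top_iff, isFiniteLength_iff_isNoetherian_isArtinian] at h1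
    exact isArtinian_of_tower R h1.2
  refine { krullDim_eq := ?_, exists_regular := ⟨Y, hYm, hY⟩ }
  rw [← IsLocalRing.maximalIdeal_height_eq_ringKrullDim]
  have hle : Ideal.span {Y} ≤ maximalIdeal _ := (Ideal.span_singleton_le_iff_mem _).mpr hYm
  have hmin : maximalIdeal _ ∈ (Ideal.span {Y}).minimalPrimes := by
    refine ⟨⟨inferInstance, hle⟩, fun q hq _ z hz ↦ ?_⟩
    obtain ⟨n, hn⟩ := exists_pow_mem_span_of_isArtinian (b := Y) hz
    exact hq.1.mem_of_pow_mem n (hq.2 hn)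
  have h1 : (maximalIdeal (quasiTrivialExtension J α)).height = 1 := by
    refine le_antisymm ?_ ?_
    · exact Ideal.height_le_one_of_isPrincipal_of_mem_minimalPrimes _ _ hmin
    · rw [← Ideal.height_span_singleton_eq_one_of_mem_nonZeroDivisors hY hYm]
      exact Ideal.height_mono hle
  rw [h1]
  rfl

/-! ### Coordinates on the extension and on its total ring of fractions. -/

section Fractions

variable {Q : Type*} [CommRing Q] [Algebra R Q] {A : Type u} [CommRing A]
  {B : Type*} [CommRing B] [Algebra A B]

variable (J α A B Q) in
/-- Identifications of `A` with `R ⋉^α J` and of the `A`-algebra `B` with `Q ⋉^α Q`. -/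
structure ExtensionData where
  /-- the identification of `A` with the quasi-trivial extension -/
  e : A ≃+* quasiTrivialExtension J α
  /-- the parameter of the extension of `Q` -/
  β : Q
  -- Keeping `β` separate lets it be literally `0` or `1` for the idealization and the fiber
  -- product, where the image of `α` is only equal to it.
  β_eq : β = algebraMap R Q α
  /-- the identification of `B` with a quadratic algebra -/
  ψ : B ≃+* QuadraticAlgebra Q 0 β
  re_eq : ∀ z, (ψ (algebraMap A B z)).re = algebraMap R Q (e z).1.re
  im_eq : ∀ z, (ψ (algebraMap A B z)).im = algebraMap R Q (e z).1.im

namespace ExtensionData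

variable (D : ExtensionData J α Q A B)

/-- The projection `A → R`. -/
def proj : A →+* R := (reHom J α).comp D.e

/-- The element of `A` with given coordinates. -/
def elt (r : R) {j : R} (hj : j ∈ J) : A := D.e.symm ⟨⟨r, j⟩, hj⟩

theorem e_elt (r : R) {j : R} (hj : j ∈ J) : D.e (D.elt r hj) = ⟨⟨r, j⟩, hj⟩ :=
  D.e.apply_symm_apply _

theorem proj_elt (r : R) {j : R} (hj : j ∈ J) : D.proj (D.elt r hj) = r :=
  congrArg (fun z : quasiTrivialExtension J α ↦ z.1.re) (D.e_elt r hj)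

theorem exists_elt (z : A) : ∃ r, ∃ j, ∃ hj : j ∈ J, z = D.elt r hj :=
  ⟨(D.e z).1.re, (D.e z).1.im, (D.e z).2, (D.e.symm_apply_apply z).symm⟩

theorem proj_surjective : RingHomSurjective D.proj :=
  ⟨fun r ↦ ⟨D.elt r J.zero_mem, D.proj_elt r _⟩⟩

theorem re_smul (r : R) {j : R} (hj : j ∈ J) (b : B) :
    (D.ψ (D.elt r hj • b)).re = algebraMap R Q r * (D.ψ b).re := by
  rw [Algebra.smul_def, map_mul, QuadraticAlgebra.re_mul, D.re_eq, e_elt]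
  simp

theorem im_smul (r : R) {j : R} (hj : j ∈ J) (b : B) :
    (D.ψ (D.elt r hj • b)).im = algebraMap R Q r * (D.ψ b).im +
      algebraMap R Q j * (D.ψ b).re + algebraMap R Q α * algebraMap R Q j * (D.ψ b).im := by
  rw [Algebra.smul_def, map_mul, QuadraticAlgebra.im_mul, D.re_eq, D.im_eq, e_elt, ← D.β_eq]

theorem re_mul (b c : B) : (D.ψ (b * c)).re = (D.ψ b).re * (D.ψ c).re := by
  rw [map_mul, QuadraticAlgebra.re_mul]
  simp

theorem im_mul (b c : B) : (D.ψ (b * c)).im = (D.ψ b).re * (D.ψ c).im +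
    (D.ψ b).im * (D.ψ c).re + algebraMap R Q α * (D.ψ b).im * (D.ψ c).im := by
  rw [map_mul, QuadraticAlgebra.im_mul, ← D.β_eq]

theorem re_one : (D.ψ 1).re = 1 := by rw [map_one, QuadraticAlgebra.re_one]

theorem im_one : (D.ψ 1).im = 0 := by rw [map_one, QuadraticAlgebra.im_one]

theorem ext {b c : B} (h₁ : (D.ψ b).re = (D.ψ c).re) (h₂ : (D.ψ b).im = (D.ψ c).im) : b = c :=
  D.ψ.injective (QuadraticAlgebra.ext h₁ h₂)

/-- The element of `B` with given coordinates. -/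
def pair (s t : Q) : B := D.ψ.symm ⟨s, t⟩

@[simp]
theorem re_pair (s t : Q) : (D.ψ (D.pair s t)).re = s := by
  rw [pair, RingEquiv.apply_symm_apply]

@[simp]
theorem im_pair (s t : Q) : (D.ψ (D.pair s t)).im = t := by
  rw [pair, RingEquiv.apply_symm_apply]

include D in
theorem isCohenMacaulayLocalDimOne [IsCohenMacaulayLocalDimOne R]
    (hJ : J ≤ maximalIdeal R) {y : R} (hy : y ∈ R⁰) (hyJ : y ∈ J) :
    IsCohenMacaulayLocalDimOne A :=
  have := isCohenMacaulayLocalDimOne_quasiTrivialExtension (α := α) hJ hy hyJ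
  IsCohenMacaulayLocalDimOne.of_ringEquiv D.e

theorem elt_mem_maximalIdeal_iff [IsCohenMacaulayLocalDimOne R] [IsLocalRing A]
    (hJ : J ≤ maximalIdeal R) (r : R) {j : R} (hj : j ∈ J) :
    D.elt r hj ∈ maximalIdeal A ↔ r ∈ maximalIdeal R := by
  refine not_congr ⟨fun hu ↦ ?_, fun hu ↦ ?_⟩
  · have := hu.map D.proj
    rwa [D.proj_elt] at this
  · exact (isUnit_quasiTrivialExtension hJ (z := ⟨⟨r, j⟩, hj⟩) hu).map D.e.symm

variable [IsFractionRing R Q]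

include D in
theorem algebraMap_injective : Function.Injective (algebraMap A B) := by
  intro z w h
  refine D.e.injective (quasiTrivialExtension_ext ?_ ?_)
  · apply IsFractionRing.injective R Q
    rw [← D.re_eq, ← D.re_eq, h]
  · apply IsFractionRing.injective R Q
    rw [← D.im_eq, ← D.im_eq, h]

theorem isUnit_algebraMap_elt {y : R} (hy : y ∈ R⁰) :
    IsUnit (algebraMap A B (D.elt y J.zero_mem)) := by
  refine isUnit_iff_exists_inv.mpr ⟨D.pair (↑(toUnit Q hy)⁻¹ : Q) 0, D.ext ?_ ?_⟩
  · rw [← Algebra.smul_def, D.re_smul, re_pair, re_one, ← coe_toUnit hy, Units.mul_inv]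
  · rw [← Algebra.smul_def, D.im_smul, re_pair, im_pair, im_one]
    simp

theorem elt_mem_nonZeroDivisors {y : R} (hy : y ∈ R⁰) : D.elt y J.zero_mem ∈ A⁰ := by
  rw [mem_nonZeroDivisors_iff_right]
  intro x hx
  apply D.algebraMap_injective
  rw [map_zero]
  refine (D.isUnit_algebraMap_elt hy).mul_left_eq_zero.mp ?_
  rw [← map_mul, hx, map_zero]

include D in
-- A regular element of `A` divides a power of the image of `y`, which is invertible in `B`.
-- Conversely, common denominators from `R` suffice.
theorem isFractionRing [IsCohenMacaulayLocalDimOne R] [IsCohenMacaulayLocalDimOne A]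
    (hJ : J ≤ maximalIdeal R) {y : R} (hy : y ∈ R⁰) (hyJ : y ∈ J) : IsFractionRing A B where
  map_units b := by
    obtain ⟨n, hn⟩ := exists_pow_mem_span b.2
      ((D.elt_mem_maximalIdeal_iff hJ y J.zero_mem).mpr (hJ hyJ))
    obtain ⟨r, hr⟩ := Ideal.mem_span_singleton'.mp hn
    have h1 := (D.isUnit_algebraMap_elt hy).pow n
    rw [← map_pow, ← hr, map_mul] at h1
    exact isUnit_of_mul_isUnit_right h1
  surj b := by
    obtain ⟨⟨p, s⟩, hp⟩ := IsLocalization.surj R⁰ (D.ψ b).re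
    obtain ⟨⟨q, t⟩, hq⟩ := IsLocalization.surj R⁰ (D.ψ b).im
    -- The extra factor `y` puts the second coordinate of the numerator into `J`.
    have hd : (s * t * y : R) ∈ R⁰ := mul_mem (mul_mem s.2 t.2) hy
    have hj : s * q * y ∈ J := J.mul_mem_left _ hyJ
    refine ⟨⟨D.elt (t * p * y) hj, ⟨_, D.elt_mem_nonZeroDivisors hd⟩⟩, D.ext ?_ ?_⟩
    · rw [mul_comm, ← Algebra.smul_def, D.re_smul, D.re_eq, e_elt]
      simp only [map_mul] at hp ⊢
      linear_combination (algebraMap R Q t * algebraMap R Q y) * hp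
    · rw [mul_comm, ← Algebra.smul_def, D.im_smul, D.im_eq, e_elt]
      simp only [map_mul, map_zero] at hq ⊢
      linear_combination (algebraMap R Q s * algebraMap R Q y) * hq
  exists_of_eq h := ⟨1, by rw [D.algebraMap_injective h]⟩

/-! ### The lattice `T × K` of the extension. -/

section Canonical

variable (T : Subalgebra R Q) (K : Submodule R Q)
  (hJT : ∀ j ∈ J, ∀ t ∈ T, ∃ s : R, algebraMap R Q j * t = algebraMap R Q s)
  (h1K : 1 ∈ K) (hKT : K ≤ T.toSubmodule)

include h1K in
omit [IsFractionRing R Q] in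
theorem algebraMap_mem (r : R) : algebraMap R Q r ∈ K := by
  rw [Algebra.algebraMap_eq_smul_one]
  exact K.smul_mem r h1K

include hJT h1K in
omit [IsFractionRing R Q] in
theorem mul_mem_of_mem {j : R} (hj : j ∈ J) {t : Q} (ht : t ∈ T) : algebraMap R Q j * t ∈ K := by
  obtain ⟨s, hs⟩ := hJT j hj t ht
  rw [hs]
  exact algebraMap_mem K h1K s

/-- The submodule `T × K`. -/
def canonical : Submodule A B where
  carrier := {b | (D.ψ b).re ∈ T ∧ (D.ψ b).im ∈ K}
  zero_mem' := by
    rw [Set.mem_ofPred_eq, map_zero]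
    exact ⟨T.zero_mem, K.zero_mem⟩
  add_mem' := by
    intro b c hb hc
    rw [Set.mem_ofPred_eq, map_add]
    exact ⟨T.add_mem hb.1 hc.1, K.add_mem hb.2 hc.2⟩
  smul_mem' := by
    intro z b hb
    obtain ⟨r, j, hj, rfl⟩ := D.exists_elt z
    rw [Set.mem_ofPred_eq, D.re_smul, D.im_smul]
    refine ⟨T.mul_mem (T.algebraMap_mem r) hb.1, K.add_mem (K.add_mem ?_ ?_) ?_⟩
    · rw [← Algebra.smul_def]
      exact K.smul_mem r hb.2
    · exact mul_mem_of_mem T K hJT h1K hj hb.1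
    · rw [mul_assoc, ← Algebra.smul_def]
      exact K.smul_mem _ (mul_mem_of_mem T K hJT h1K hj (hKT hb.2))

omit [IsFractionRing R Q] in
theorem mem_canonical {b : B} : b ∈ D.canonical T K hJT h1K hKT ↔
    (D.ψ b).re ∈ T ∧ (D.ψ b).im ∈ K := Iff.rfl

omit [IsFractionRing R Q] in
theorem one_mem_canonical : 1 ∈ D.canonical T K hJT h1K hKT := by
  rw [mem_canonical, re_one, im_one]
  exact ⟨T.one_mem, K.zero_mem⟩

omit [IsFractionRing R Q] in
-- The square is `T × T`: products stay there because `K ⊆ T`, and `(s, t) = (s, 0) (1, 0) + (t, 0)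
-- (0, 1)`, where `(0, 1)` is available because `1 ∈ K`.
theorem mem_canonical_sq {b : B} : b ∈ D.canonical T K hJT h1K hKT ^ 2 ↔
    (D.ψ b).re ∈ T ∧ (D.ψ b).im ∈ T := by
  rw [pow_two]
  constructor
  · intro h
    induction h using Submodule.mul_induction_on' with
    | mem_mul_mem b hb c hc =>
      rw [re_mul, im_mul]
      have hb' := hKT hb.2
      have hc' := hKT hc.2
      exact ⟨T.mul_mem hb.1 hc.1, T.add_mem (T.add_mem (T.mul_mem hb.1 hc') (T.mul_mem hb' hc.1))
        (T.mul_mem (T.mul_mem (T.algebraMap_mem α) hb') hc')⟩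
    | add b _ c _ hb hc =>
      rw [map_add]
      exact ⟨T.add_mem hb.1 hc.1, T.add_mem hb.2 hc.2⟩
  · rintro ⟨h1, h2⟩
    have h3 : b = D.pair (D.ψ b).re 0 * 1 + D.pair (D.ψ b).im 0 * D.pair 0 1 := by
      refine D.ext ?_ ?_
      · rw [map_add, QuadraticAlgebra.re_add, re_mul, re_mul]
        simp [QuadraticAlgebra.re_one]
      · rw [map_add, QuadraticAlgebra.im_add, im_mul, im_mul]
        simp [QuadraticAlgebra.re_one, QuadraticAlgebra.im_one]
    rw [h3]
    refine Submodule.add_mem _ (Submodule.mul_mem_mul ?_ (D.one_mem_canonical T K hJT h1K hKT))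
      (Submodule.mul_mem_mul ?_ ?_) <;> rw [mem_canonical, re_pair, im_pair]
    · exact ⟨h1, K.zero_mem⟩
    · exact ⟨h2, K.zero_mem⟩
    · exact ⟨T.zero_mem, h1K⟩

omit [IsFractionRing R Q] in
theorem canonical_pow_three :
    D.canonical T K hJT h1K hKT ^ 3 = D.canonical T K hJT h1K hKT ^ 2 := by
  refine le_antisymm ?_ ?_
  · rw [pow_succ, Submodule.mul_le]
    intro b hb c hc
    rw [mem_canonical_sq] at hb ⊢
    rw [re_mul, im_mul]
    have hc' := hKT hc.2
    exact ⟨T.mul_mem hb.1 hc.1, T.add_mem (T.add_mem (T.mul_mem hb.1 hc') (T.mul_mem hb.2 hc.1))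
      (T.mul_mem (T.mul_mem (T.algebraMap_mem α) hb.2) hc')⟩
  · rw [pow_succ _ 2]
    intro b hb
    rw [← mul_one b]
    exact Submodule.mul_mem_mul hb (D.one_mem_canonical T K hJT h1K hKT)

omit [IsFractionRing R Q] in
-- The second coordinate induces `(T × T) / (T × K) ≅ T / K`. It is semilinear over `A → R`, since
-- the remaining terms in the action of `(r, j)` lie in `J T ⊆ R ⊆ K`.
theorem exists_bijective_canonical : let _ := D.proj_surjective
    ∃ f : Subquotient (D.canonical T K hJT h1K hKT ^ 2) (D.canonical T K hJT h1K hKT) →ₛₗ[D.proj]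
      Subquotient T.toSubmodule K, Function.Bijective f := by
  intro _
  refine exists_bijective_subquotient
    { toFun := fun b ↦ (D.ψ b).im, map_zero' := by simp, map_add' := by simp } ?_ ?_ ?_ ?_
  · exact fun b hb ↦ ((D.mem_canonical_sq T K hJT h1K hKT).mp hb).2
  · intro t ht
    refine ⟨D.pair 0 t, (D.mem_canonical_sq T K hJT h1K hKT).mpr ?_, ?_⟩
    · rw [re_pair, im_pair]
      exact ⟨T.zero_mem, ht⟩
    · simp
  · intro b hb
    have := ((D.mem_canonical_sq T K hJT h1K hKT).mp hb).1
    exact ⟨fun h ↦ ⟨this, h⟩, fun h ↦ h.2⟩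
  · intro z b hb
    have hb' := (D.mem_canonical_sq T K hJT h1K hKT).mp hb
    obtain ⟨r, j, hj, rfl⟩ := D.exists_elt z
    change (D.ψ (D.elt r hj • b)).im - D.proj (D.elt r hj) • (D.ψ b).im ∈ K
    rw [D.im_smul, proj_elt, Algebra.smul_def, add_assoc, add_sub_cancel_left]
    refine K.add_mem (mul_mem_of_mem T K hJT h1K hj hb'.1) ?_
    rw [mul_assoc, ← Algebra.smul_def]
    exact K.smul_mem _ (mul_mem_of_mem T K hJT h1K hj hb'.2)

omit [IsFractionRing R Q] in
theorem minGenerators_canonical_eq_one_iff :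
    minGenerators A (Subquotient (D.canonical T K hJT h1K hKT ^ 2)
      (D.canonical T K hJT h1K hKT)) = 1 ↔ minGenerators R (Subquotient T.toSubmodule K) = 1 := by
  have := D.proj_surjective
  obtain ⟨f, hf⟩ := D.exists_bijective_canonical T K hJT h1K hKT
  exact minGenerators_eq_one_iff_of_bijective f hf

omit [IsFractionRing R Q] in
theorem relLength_canonical :
    relLength (D.canonical T K hJT h1K hKT) (D.canonical T K hJT h1K hKT ^ 2) =
      relLength K T.toSubmodule := by
  have := D.proj_surjective
  obtain ⟨f, hf⟩ := D.exists_bijective_canonical T K hJT h1K hKT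
  exact length_eq_of_bijective f hf

/-- Let `(s, t)` be multiplied into `T × K` by `𝔪 × J`. The elements `(r, 0)` give `t ∈ K : 𝔪`; the
elements `(0, j)` then give `J s ⊆ K`, so `s ∈ K : J = K : (K : T) = T`. The socle is thus that of
`K`, placed in the second coordinate. -/
theorem isCanonicalLattice_canonical [IsCohenMacaulayLocalDimOne R] [IsCohenMacaulayLocalDimOne A]
    (hK : IsCanonicalLattice K) (hJ : J ≤ maximalIdeal R) {y : R} (hy : y ∈ R⁰) (hyJ : y ∈ J)
    (hT : IsLattice T.toSubmodule) (hKJ : ofIdeal Q J = K / T.toSubmodule) :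
    IsCanonicalLattice (D.canonical T K hJT h1K hKT) := by
  -- One factor `y` clears denominators of `T`; the other moves the second coordinate into `J`.
  refine ⟨⟨⟨1, one_mem _, ?_⟩, ⟨D.elt (y * y) J.zero_mem,
    D.elt_mem_nonZeroDivisors (mul_mem hy hy), ?_⟩⟩, ?_⟩
  · rw [map_one]
    exact D.one_mem_canonical T K hJT h1K hKT
  · intro b hb
    obtain ⟨s, hs⟩ := hJT y hyJ _ hb.1
    obtain ⟨t, ht⟩ := hJT y hyJ _ (hKT hb.2)
    refine ⟨D.elt (y * s) (J.mul_mem_right t hyJ), D.ext ?_ ?_⟩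
    · rw [← Algebra.smul_def, D.re_smul, D.re_eq, e_elt, map_mul, map_mul, mul_assoc, hs]
    · rw [← Algebra.smul_def, D.im_smul, D.im_eq, e_elt]
      simp only [map_mul, map_zero, zero_mul, mul_zero, add_zero]
      rw [mul_assoc, ht]
  · obtain ⟨s, hsK, hms, hs⟩ := hK.exists_socle
    refine ⟨D.pair 0 s, fun h ↦ hsK ?_, ?_, ?_⟩
    · have := h.2
      rwa [im_pair] at this
    · intro z hz
      obtain ⟨r, j, hj, rfl⟩ := D.exists_elt z
      rw [elt_mem_maximalIdeal_iff D hJ] at hz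
      rw [mem_canonical, D.re_smul, D.im_smul, re_pair, im_pair, mul_zero, mul_zero, add_zero,
        mul_assoc, ← Algebra.smul_def, ← Algebra.smul_def, ← Algebra.smul_def]
      exact ⟨T.zero_mem, K.add_mem (hms r hz) (K.smul_mem _ (hms j (hJ hj)))⟩
    · intro b hb
      have him : ∀ r ∈ maximalIdeal R, r • (D.ψ b).im ∈ K := by
        intro r hr
        have := (hb _ ((D.elt_mem_maximalIdeal_iff hJ r J.zero_mem).mpr hr)).2
        rw [D.im_smul] at this
        simpa [Algebra.smul_def] using this
      obtain ⟨r, hr⟩ := hs _ him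
      have hre : (D.ψ b).re ∈ T := by
        have h1 := hK.div_div_self hT
        rw [← hKJ] at h1
        have h2 : (D.ψ b).re ∈ K / ofIdeal Q J := by
          rw [Submodule.mem_div_iff_forall_mul_mem]
          rintro _ ⟨j, hj, rfl⟩
          have h3 := (hb _ ((D.elt_mem_maximalIdeal_iff hJ 0 hj).mpr (zero_mem _))).2
          rw [D.im_smul, map_zero, zero_mul, zero_add, mul_assoc, ← Algebra.smul_def,
            ← Algebra.smul_def, ← Algebra.smul_def] at h3
          -- The twisting term `α j t` is already in `K`, because `j ∈ 𝔪`; this is why `α` plays no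
          -- role.
          have h4 := K.sub_mem h3 (K.smul_mem α (him j (hJ hj)))
          rwa [add_sub_cancel_right, Algebra.smul_def, mul_comm] at h4
        rw [h1] at h2
        exact h2
      refine ⟨D.elt r J.zero_mem, ?_⟩
      rw [mem_canonical, map_sub, QuadraticAlgebra.re_sub, QuadraticAlgebra.im_sub, D.re_smul,
        D.im_smul, re_pair, im_pair]
      simpa [← Algebra.smul_def] using And.intro hre hr

include D hJT h1K hKT in
/-- The quasi-trivial extension is `n`-Goto if and only if `T / K` has length `n`. -/
theorem isGoto_iff [IsCohenMacaulayLocalDimOne R]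
    (hK : IsCanonicalLattice K) (hJ : J ≤ maximalIdeal R) {y : R} (hy : y ∈ R⁰) (hyJ : y ∈ J)
    (hT : IsLattice T.toSubmodule) (hKJ : ofIdeal Q J = K / T.toSubmodule) (n : ℕ) :
    IsGoto n A ↔ relLength K T.toSubmodule = n := by
  have := D.isCohenMacaulayLocalDimOne hJ hy hyJ
  have := D.isFractionRing hJ hy hyJ
  have hC := D.isCanonicalLattice_canonical T K hJT h1K hKT hK hJ hy hyJ hT hKJ
  have h3 := D.canonical_pow_three T K hJT h1K hKT
  rw [isGoto_iff_of_isCanonicalLattice hC (D.one_mem_canonical T K hJT h1K hKT) h3,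
    D.relLength_canonical T K hJT h1K hKT]
  exact and_iff_right h3

end Canonical

end ExtensionData

end Fractions

end Extension

/-! ### Colon ideals of finite birational extensions -/

section Colon

open IsLocalRing (maximalIdeal)

variable {R : Type u} [CommRing R]

theorem mem_colonIdeal {T : Subalgebra R (FractionRing R)} {r : R} :
    r ∈ colonIdeal T ↔ ∀ t ∈ T, ∃ s : R,
      algebraMap R (FractionRing R) r * t = algebraMap R (FractionRing R) s := Iff.rfl

theorem idealDiv_eq_scale (I : Ideal R) {a : R} (ha : a ∈ R⁰) :
    idealDiv I a = scale (toUnit (FractionRing R) ha)⁻¹ (ofIdeal (FractionRing R) I) := by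
  ext q
  rw [mem_scale]
  constructor
  · rintro ⟨x, hx, h⟩
    exact ⟨_, ⟨x, hx, rfl⟩, by
      rw [Units.inv_mul_eq_iff_eq_mul]
      exact h.symm⟩
  · rintro ⟨_, ⟨x, hx, rfl⟩, rfl⟩
    exact ⟨x, hx, by rw [← coe_toUnit ha, Units.mul_inv_cancel_left]; rfl⟩

variable (T : Subalgebra R (FractionRing R))

theorem isLattice_of_finite [Module.Finite R T] : IsLattice T.toSubmodule := by
  refine ⟨⟨1, one_mem _, by rw [map_one]; exact T.one_mem⟩, ?_⟩
  obtain ⟨s, hs⟩ := (Module.Finite.iff_fg (N := T.toSubmodule)).mp inferInstance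
  obtain ⟨b, hb⟩ := IsLocalization.exist_integer_multiples_of_finset R⁰ s
  have hle : T.toSubmodule ≤ (Submodule.comap (LinearMap.mulLeft R
      (algebraMap R (FractionRing R) b)) (1 : Submodule R (FractionRing R))) := by
    rw [← hs, Submodule.span_le]
    intro q hq
    obtain ⟨r, hr⟩ := hb q hq
    rw [SetLike.mem_coe, Submodule.mem_comap, LinearMap.mulLeft_apply, ← Algebra.smul_def, ← hr]
    exact Submodule.algebraMap_mem r
  refine ⟨b, b.2, fun q hq ↦ ?_⟩
  obtain ⟨r, hr⟩ := Submodule.mem_one.mp (hle hq)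
  exact ⟨r, hr.symm⟩

theorem colonIdeal_le_maximalIdeal [IsLocalRing R] (hT : T ≠ ⊥) :
    colonIdeal T ≤ maximalIdeal R := by
  refine IsLocalRing.le_maximalIdeal fun h ↦ hT (eq_bot_iff.mpr fun t ht ↦ ?_)
  obtain ⟨s, hs⟩ := mem_colonIdeal.mp ((Ideal.eq_top_iff_one _).mp h) t ht
  rw [map_one, one_mul] at hs
  rw [hs]
  exact Subalgebra.algebraMap_mem _ s

variable {T} [IsCohenMacaulayLocalDimOne R] {K : Submodule R (FractionRing R)}

/-- `R : T` and `K : T` agree: if `q T ⊆ K` then `q T K ⊆ q T ⊆ K`, so `q T ⊆ K : K = R`. -/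
theorem ofIdeal_colonIdeal (hK : IsCanonicalLattice K) (h1 : 1 ∈ K) (hKT : K ≤ T.toSubmodule) :
    ofIdeal (FractionRing R) (colonIdeal T) = K / T.toSubmodule := by
  ext q
  rw [Submodule.mem_div_iff_forall_mul_mem]
  constructor
  · rintro ⟨r, hr, rfl⟩ t ht
    obtain ⟨s, hs⟩ := hr t ht
    rw [Algebra.linearMap_apply, hs, Algebra.algebraMap_eq_smul_one]
    exact K.smul_mem s h1
  · intro hq
    have h2 : ∀ t ∈ T, q * t ∈ (1 : Submodule R (FractionRing R)) := by
      intro t ht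
      rw [← hK.div_self, Submodule.mem_div_iff_forall_mul_mem]
      intro k hk
      rw [mul_assoc]
      exact hq _ (T.mul_mem ht (hKT hk))
    obtain ⟨r, hr⟩ := Submodule.mem_one.mp (h2 1 T.one_mem)
    rw [mul_one] at hr
    refine mem_ofIdeal.mpr ⟨r, fun t ht ↦ ?_, hr⟩
    obtain ⟨s, hs⟩ := Submodule.mem_one.mp (h2 t ht)
    exact ⟨s, by rw [hr, hs]⟩

theorem relLength_top {A M : Type*} [CommRing A] [AddCommGroup M] [Module A M]
    (N : Submodule A M) : relLength N ⊤ = Module.length A (M ⧸ N) := by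
  have h1 := relLength_eq_of_addHom (σ := RingHom.id A) (P₀ := N) (P := ⊤) (N₀ := ⊥) (N := ⊤)
    N.mkQ.toAddMonoidHom (fun _ _ ↦ trivial) (fun y _ ↦ by
      obtain ⟨x, rfl⟩ := Submodule.Quotient.mk_surjective _ y
      exact ⟨x, trivial, by simp⟩) (fun x _ ↦ by simp) (fun r x _ ↦ by simp)
  rw [h1, relLength_bot_top]

/-- Dualizing `K ⊆ T` into `K` gives `K : T ⊆ K : K`, which is `J ⊆ R`. -/
theorem relLength_eq_length_quotient (hK : IsCanonicalLattice K) (h1 : 1 ∈ K)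
    (hKT : K ≤ T.toSubmodule) (hT : IsLattice T.toSubmodule) :
    relLength K T.toSubmodule = Module.length R (R ⧸ colonIdeal T) := by
  have htop : ofIdeal (FractionRing R) (⊤ : Ideal R) = 1 := by
    rw [ofIdeal, Submodule.map_top, ← Submodule.one_eq_range]
  rw [← relLength_top, ← relLength_ofIdeal (Q := FractionRing R), htop,
    ofIdeal_colonIdeal hK h1 hKT, ← hK.div_self, hK.relLength_div hK.toIsLattice hT hKT]

end Colon

/-! ### The rings `R ⋉^α J` and `R ×_{R/J} R` -/

section Instances

variable {R : Type u} [CommRing R] (J : Ideal R)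

/-- The inclusion `R ⋉^α J → Q(R) ⋉^α Q(R)`. -/
def quasiTrivialMap (α : R) : quasiTrivialExtension J α →+*
    QuadraticAlgebra (FractionRing R) 0 (algebraMap R (FractionRing R) α) where
  toFun z := ⟨algebraMap R (FractionRing R) z.1.re, algebraMap R (FractionRing R) z.1.im⟩
  map_one' := QuadraticAlgebra.ext (map_one (algebraMap R (FractionRing R)))
    (map_zero (algebraMap R (FractionRing R)))
  map_mul' z w := by ext <;> simp
  map_zero' := by ext <;> simp
  map_add' z w := by ext <;> simp

/-- The data of the extension `R ⋉^α J`. -/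
def quasiTrivialData (α : R) : let _ := (quasiTrivialMap J α).toAlgebra
    ExtensionData J α (FractionRing R) (quasiTrivialExtension J α)
      (QuadraticAlgebra (FractionRing R) 0 (algebraMap R (FractionRing R) α)) :=
  let _ := (quasiTrivialMap J α).toAlgebra
  { e := RingEquiv.refl _
    β := _
    β_eq := rfl
    ψ := RingEquiv.refl _
    re_eq := fun _ ↦ rfl
    im_eq := fun _ ↦ rfl }

/-- The data of the idealization `R ⋉ J`. -/
def idealizationData : ExtensionData J (0 : R) (FractionRing R) (Idealization J)
    (IdealizationFractions R) where
  e := RingEquiv.refl _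
  β := 0
  β_eq := (map_zero _).symm
  ψ := RingEquiv.refl _
  re_eq _ := rfl
  im_eq _ := rfl

/-- The isomorphism `S × S ≅ S ⋉^1 S`. -/
def prodEquiv (S : Type*) [CommRing S] : S × S ≃+* QuadraticAlgebra S 0 1 where
  toFun z := ⟨z.1, z.2 - z.1⟩
  invFun z := (z.re, z.re + z.im)
  left_inv z := by simp
  right_inv z := by ext <;> simp
  map_mul' z w := by
    ext
    · simp
    · simp
      ring
  map_add' z w := by
    ext
    · simp
    · simp
      ring

theorem mem_fiberProduct {z : R × R} : z ∈ fiberProduct J ↔ z.2 - z.1 ∈ J := by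
  rw [← Ideal.Quotient.eq]
  exact eq_comm

/-- The isomorphism `R ×_{R/J} R ≅ R ⋉^1 J`. -/
def fiberProductEquiv : fiberProduct J ≃+* quasiTrivialExtension J 1 where
  toFun z := ⟨prodEquiv R z.1, (mem_fiberProduct J).mp z.2⟩
  invFun z := ⟨(prodEquiv R).symm z.1, (mem_fiberProduct J).mpr (by
    change z.1.re + z.1.im - z.1.re ∈ J
    rw [add_sub_cancel_left]
    exact z.2)⟩
  left_inv z := Subtype.ext ((prodEquiv R).symm_apply_apply z.1)
  right_inv z := Subtype.ext ((prodEquiv R).apply_symm_apply z.1)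
  map_mul' z w := Subtype.ext (map_mul (prodEquiv R) z.1 w.1)
  map_add' z w := Subtype.ext (map_add (prodEquiv R) z.1 w.1)

/-- The data of the fiber product. -/
def fiberProductData : ExtensionData J (1 : R) (FractionRing R) (fiberProduct J)
    (FractionRing R × FractionRing R) where
  e := fiberProductEquiv J
  β := 1
  β_eq := (map_one _).symm
  ψ := prodEquiv _
  re_eq _ := rfl
  im_eq z := (map_sub (algebraMap R (FractionRing R)) z.1.2 z.1.1).symm

variable (T : Subalgebra R (FractionRing R)) (K : Submodule R (FractionRing R))
  (hJT : ∀ j ∈ J, ∀ t ∈ T, ∃ s : R,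
    algebraMap R (FractionRing R) j * t = algebraMap R (FractionRing R) s)
  (h1K : 1 ∈ K) (hKT : K ≤ T.toSubmodule)

theorem fiberProductCanonical_eq :
    fiberProductCanonical J T K = (fiberProductData J).canonical T K hJT h1K hKT := by
  refine le_antisymm (Submodule.span_le.mpr ?_) fun z hz ↦ Submodule.subset_span ?_
  · rintro _ ⟨s, hs, k, hk, rfl⟩
    refine ⟨hs, ?_⟩
    change s + k - s ∈ K
    rwa [add_sub_cancel_left]
  · exact ⟨z.1, hz.1, z.2 - z.1, hz.2, by simp⟩

theorem idealizationCanonical_eq :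
    idealizationCanonical J T K = (idealizationData J).canonical T K hJT h1K hKT :=
  le_antisymm (Submodule.span_le.mpr fun _ hz ↦ hz) fun _ hz ↦ Submodule.subset_span hz

end Instances

/-! ### Cyclic quotients `S / K` -/

section Cyclic

open IsLocalRing (maximalIdeal)

variable {R : Type u} [CommRing R]

/-- The reduction equation is shifted by one exponent so that only positive powers occur, even for
`r = 0`. -/
theorem idealDiv_pow_succ {Q : Type*} [CommRing Q] [Algebra R Q] [IsFractionRing R Q] {I : Ideal R}
    {a : R} (ha : a ∈ R⁰) {r : ℕ} (h : I ^ (r + 1) = Ideal.span {a} * I ^ r) :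
    scale (toUnit Q ha)⁻¹ (ofIdeal Q I) ^ (r + 2) =
      scale (toUnit Q ha)⁻¹ (ofIdeal Q I) ^ (r + 1) := by
  have h' : I ^ (r + 1 + 1) = Ideal.span {a} * I ^ (r + 1) := by
    rw [pow_succ, h, mul_assoc, ← pow_succ]
    exact congrArg _ h
  have h2 := congrArg (ofIdeal Q) h'
  rw [ofIdeal_span_mul ha, ofIdeal_pow, ofIdeal_pow] at h2
  have e : (toUnit Q ha)⁻¹ ^ (r + 2) * toUnit Q ha = (toUnit Q ha)⁻¹ ^ (r + 1) := by
    rw [pow_succ, inv_mul_cancel_right]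
  rw [scale_pow, scale_pow, h2, scale_scale, e]

/-- The stable power satisfies `K ^ N K ^ N = K ^ (2 N) = K ^ N`, so it is a subalgebra; it contains
`K` because `1 ∈ K`. -/
theorem adjoin_eq_pow {Q : Type*} [CommRing Q] [Algebra R Q] {K : Submodule R Q} (h1 : 1 ∈ K)
    {N : ℕ} (hN : 1 ≤ N) (h : K ^ (N + 1) = K ^ N) :
    (Algebra.adjoin R (K : Set Q)).toSubmodule = K ^ N := by
  have h1' : (1 : Submodule R Q) ≤ K := Submodule.one_le.mpr h1
  have hKN : K ≤ K ^ N := by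
    calc K = K ^ 1 := (pow_one K).symm
      _ ≤ K ^ N := pow_le_pow_right' h1' hN
  let S : Subalgebra R Q := (K ^ N).toSubalgebra
    (Submodule.one_le.mp (h1'.trans hKN)) fun x y hx hy ↦ by
      have := Submodule.mul_mem_mul hx hy
      rwa [← pow_add, pow_eq_of_pow_succ_eq h (by omega : N ≤ N + N)] at this
  refine le_antisymm ?_ ?_
  · have : Algebra.adjoin R (K : Set Q) ≤ S := Algebra.adjoin_le hKN
    exact this
  · have hle : K ≤ (Algebra.adjoin R (K : Set Q)).toSubmodule := Algebra.subset_adjoin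
    clear h hKN S
    induction N, hN using Nat.le_induction with
    | base => rwa [pow_one]
    | succ N _ ih =>
      rw [pow_succ, Submodule.mul_le]
      exact fun x hx y hy ↦ Subalgebra.mul_mem _ (ih hx) (hle hy)

/-- If `S / K` is cyclic and non-zero then `K ^ 2 = S`. -/
theorem sq_eq_of_minGenerators_eq_one [IsLocalRing R] {Q : Type*} [CommRing Q] [Algebra R Q]
    {K : Submodule R Q} {S : Subalgebra R Q} [Module.Finite R S] (hKS : K ≤ S.toSubmodule)
    (h1 : 1 ∈ K) {N : ℕ} (hN : S.toSubmodule = K ^ (N + 1))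
    (h : minGenerators R (Subquotient S.toSubmodule K) = 1) : K ^ 2 = S.toSubmodule := by
  obtain ⟨⟨g, hg⟩, hnt⟩ := minGenerators_eq_one_iff.mp h
  obtain ⟨⟨g, hgS⟩, rfl⟩ := Submodule.Quotient.mk_surjective _ g
  have hg' : ∀ x ∈ S, ∃ r : R, r • g - x ∈ K := by
    intro x hx
    obtain ⟨r, hr⟩ := hg (Submodule.Quotient.mk ⟨x, hx⟩)
    rw [← Submodule.Quotient.mk_smul] at hr
    exact ⟨r, subquotient_mk_eq_mk_iff.mp hr⟩
  have hnle : ¬ S.toSubmodule ≤ K := by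
    rwa [← Submodule.submoduleOf_eq_top, ← Ne, ← Submodule.Quotient.nontrivial_iff]
  have hK2 : K ≤ K ^ 2 := by
    rw [pow_two]
    intro x hx
    rw [← mul_one x]
    exact Submodule.mul_mem_mul hx h1
  have hK2S : K ^ 2 ≤ S.toSubmodule := by
    rw [pow_two, Submodule.mul_le]
    exact fun x hx y hy ↦ S.mul_mem (hKS hx) (hKS hy)
  by_contra hne
  have hgK : g ∉ K ^ 2 := by
    refine fun hgK ↦ hne (le_antisymm hK2S fun x hx ↦ ?_)
    obtain ⟨r, hr⟩ := hg' x hx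
    have := (K ^ 2).sub_mem ((K ^ 2).smul_mem r hgK) (hK2 hr)
    rwa [sub_sub_cancel] at this
  -- The generator `g` of `S` modulo `K` is not in `K ^ 2`, so an element of `K ^ 2` congruent to `r
  -- g` modulo `K` must have `r ∈ 𝔪`. The inclusion then spreads to all powers of `K`, hence to `S`,
  -- and Nakayama gives the contradiction `S ⊆ K`.
  have hle : K ^ 2 ≤ K ⊔ maximalIdeal R • S.toSubmodule := by
    intro x hx
    obtain ⟨r, hr⟩ := hg' x (hK2S hx)
    have hrm : r ∈ maximalIdeal R := by
      intro hu
      obtain ⟨r, rfl⟩ := hu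
      have h2 := (K ^ 2).smul_mem (↑r⁻¹ : R) ((K ^ 2).add_mem (hK2 hr) hx)
      rw [sub_add_cancel, smul_smul, Units.inv_mul, one_smul] at h2
      exact hgK h2
    have h2 := Submodule.sub_mem _ (Submodule.mem_sup_right (S := K)
      (Submodule.smul_mem_smul hrm hgS)) (Submodule.mem_sup_left hr)
    rwa [sub_sub_cancel] at h2
  have hpow : ∀ k, K ^ (k + 1) ≤ K ⊔ maximalIdeal R • S.toSubmodule := by
    intro k
    induction k with
    | zero =>
      rw [zero_add, pow_one]
      exact le_sup_left
    | succ k ih =>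
      rw [pow_succ, Submodule.mul_le]
      intro x hx y hy
      obtain ⟨k, hk, z, hz, rfl⟩ := Submodule.mem_sup.mp (ih hx)
      rw [add_mul]
      refine Submodule.add_mem _ (hle ?_) (Submodule.mem_sup_right ?_)
      · rw [pow_two]
        exact Submodule.mul_mem_mul hk hy
      · refine Submodule.smul_induction_on hz (fun r hr s hs ↦ ?_) fun s t hs ht ↦ ?_
        · rw [smul_mul_assoc]
          exact Submodule.smul_mem_smul hr (S.mul_mem hs (hKS hy))
        · rw [add_mul]
          exact Submodule.add_mem _ hs ht
  refine hnle (Submodule.le_of_le_smul_of_le_jacobson_bot (I := maximalIdeal R)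
    (Module.Finite.iff_fg.mp (inferInstanceAs (Module.Finite R S)))
    (IsLocalRing.maximalIdeal_le_jacobson _) ?_)
  conv_lhs => rw [hN]
  exact hpow N

end Cyclic

/-! ### Goto rings from quasi-trivial extensions -/

section Main

open IsLocalRing (maximalIdeal)

theorem IsLattice.pow {R Q : Type*} [CommRing R] [CommRing Q] [Algebra R Q] {F : Submodule R Q}
    (hF : IsLattice F) (k : ℕ) : IsLattice (F ^ k) := by
  induction k with
  | zero =>
    rw [pow_zero]
    exact isLattice_one
  | succ k ih =>
    rw [pow_succ]
    exact ih.mul hF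

theorem not_le_of_minGenerators_eq_one {A M : Type*} [CommRing A] [IsLocalRing A] [AddCommGroup M]
    [Module A M] {N P : Submodule A M} (h : minGenerators A (Subquotient P N) = 1) : ¬ P ≤ N := by
  have := (minGenerators_eq_one_iff.mp h).2
  rwa [← Submodule.submoduleOf_eq_top, ← Ne, ← Submodule.Quotient.nontrivial_iff]

variable {R : Type u} [CommRing R] [IsCohenMacaulayLocalDimOne R]
  {K : Submodule R (FractionRing R)} {T : Subalgebra R (FractionRing R)}

section Extensions

variable (hK : IsCanonicalLattice K) (h1 : 1 ∈ K) (hKT : K ≤ T.toSubmodule)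
  (hTf : Module.Finite R T) (hT : T ≠ ⊥)

include hK h1 hKT hTf hT

theorem isGoto_iff_of_extensionData {α : R} {A : Type u} [CommRing A] {B : Type*} [CommRing B]
    [Algebra A B] (D : ExtensionData (colonIdeal T) α (FractionRing R) A B) (n : ℕ) :
    IsGoto n A ↔ relLength K T.toSubmodule = n := by
  have hTl := isLattice_of_finite T
  obtain ⟨z, hz, hzT⟩ := hTl.exists_denominator
  exact D.isGoto_iff T K (fun j hj ↦ mem_colonIdeal.mp hj) h1 hKT hK
    (colonIdeal_le_maximalIdeal T hT) hz hzT hTl (ofIdeal_colonIdeal hK h1 hKT) n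

theorem isGoto_quasiTrivialExtension_iff (α : R) (n : ℕ) :
    IsGoto n (quasiTrivialExtension (colonIdeal T) α) ↔ relLength K T.toSubmodule = n :=
  let _ := (quasiTrivialMap (colonIdeal T) α).toAlgebra
  isGoto_iff_of_extensionData hK h1 hKT hTf hT (quasiTrivialData (colonIdeal T) α) n

theorem isGoto_fiberProduct_iff (n : ℕ) :
    IsGoto n (fiberProduct (colonIdeal T)) ↔ relLength K T.toSubmodule = n :=
  isGoto_iff_of_extensionData hK h1 hKT hTf hT (fiberProductData (colonIdeal T)) n

end Extensions

/-- Between `R` and its integral closure, `R` is `n`-Goto with `K ^ 2 / K` cyclic and non-zero if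
and only if `R[K] / K` is cyclic, non-zero and of length `n`. -/
theorem isGoto_and_minGenerators_iff (hK : IsCanonicalLattice K) (h1 : 1 ∈ K)
    (hTf : Module.Finite R T) (hT : T = Algebra.adjoin R (K : Set (FractionRing R)))
    {N : ℕ} (hN : K ^ (N + 2) = K ^ (N + 1)) (n : ℕ) :
    (IsGoto n R ∧ minGenerators R (Subquotient (K ^ 2) K) = 1) ↔
      (relLength K T.toSubmodule = n ∧ minGenerators R (Subquotient T.toSubmodule K) = 1) := by
  have hKT : K ≤ T.toSubmodule := by
    rw [hT]
    exact Algebra.subset_adjoin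
  have hTN : T.toSubmodule = K ^ (N + 1) := by
    rw [hT]
    exact adjoin_eq_pow h1 (by omega) hN
  rw [isGoto_iff_of_isCanonicalLattice hK h1 hN]
  constructor
  · rintro ⟨⟨h3, hn⟩, hμ⟩
    -- The Goto condition `K ^ 3 = K ^ 2` already makes `K ^ 2` the whole algebra.
    have h2 : T.toSubmodule = K ^ 2 := by
      rw [hT]
      exact adjoin_eq_pow h1 one_le_two h3
    rw [h2]
    exact ⟨hn, hμ⟩
  · rintro ⟨hn, hμ⟩
    have h2 := sq_eq_of_minGenerators_eq_one hKT h1 hTN hμ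
    rw [h2]
    refine ⟨⟨le_antisymm ?_ ?_, hn⟩, hμ⟩
    · rw [pow_succ, h2, Submodule.mul_le]
      exact fun x hx y hy ↦ T.mul_mem hx (hKT hy)
    · rw [← h2]
      exact pow_le_pow_right' (Submodule.one_le.mpr h1) (by omega)

end Main

end GotoRing

end

open GotoRing in
theorem corollary5p4 (n : ℕ) (hn : 1 ≤ n)
    (R : Type u) [CommRing R] [IsCohenMacaulayLocalDimOne R]
    (I : Ideal R) (hI : IsCanonicalIdeal I)
    (a : R) (ha : IsParameter a) (hred : IsReduction (Ideal.span {a}) I)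
    (K : Submodule R (FractionRing R)) (hK : K = idealDiv I a)
    (S : Subalgebra R (FractionRing R)) (hS : S = Algebra.adjoin R (K : Set (FractionRing R)))
    (c : Ideal R) (hc : c = colonIdeal S) :
    (∀ T : Subalgebra R (FractionRing R), Module.Finite R T → K ≤ T.toSubmodule → T ≠ ⊥ →
      ∀ J : Ideal R, J = colonIdeal T →
        [∀ α : R, IsGoto n (quasiTrivialExtension J α),
          ∃ α : R, IsGoto n (quasiTrivialExtension J α),
          IsGoto n (fiberProduct J),
          IsGoto n (Idealization J),
          Module.length R (Subquotient T.toSubmodule K) = n,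
          Module.length R (R ⧸ J) = n].TFAE) ∧
    (∀ L₁ : Submodule (fiberProduct c) (FractionRing R × FractionRing R),
      L₁ = fiberProductCanonical c S K →
      ∀ L₀ : Submodule (Idealization c) (IdealizationFractions R),
        L₀ = idealizationCanonical c S K →
        [IsGoto n R ∧
            minGenerators R (Subquotient (K ^ 2) K) = 1,
          IsGoto n (fiberProduct c) ∧
            minGenerators (fiberProduct c) (Subquotient (L₁ ^ 2) L₁) = 1,
          IsGoto n (Idealization c) ∧
            minGenerators (Idealization c) (Subquotient (L₀ ^ 2) L₀) = 1].TFAE) := by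
  have ha' := ha.mem_nonZeroDivisors
  have haI : a ∈ I := hred.1 (Ideal.mem_span_singleton_self a)
  obtain ⟨N, hN⟩ := hred.2
  rw [idealDiv_eq_scale I ha'] at hK
  have hKc : IsCanonicalLattice K := by
    rw [hK]
    exact (hI.isCanonicalLattice ha' haI).scale _
  have h1 : 1 ∈ K := by
    rw [hK]
    refine mem_scale.mpr ⟨algebraMap R _ a, algebraMap_mem_ofIdeal.mpr haI, ?_⟩
    rw [← coe_toUnit ha', Units.inv_mul]
  have hKN : K ^ (N + 2) = K ^ (N + 1) := by
    rw [hK]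
    exact idealDiv_pow_succ ha' hN
  constructor
  · rintro T hTf hKT hT J rfl
    have key := fun α ↦ isGoto_quasiTrivialExtension_iff hKc h1 hKT hTf hT α n
    tfae_have 1 → 2 := fun h ↦ ⟨0, h 0⟩
    tfae_have 2 → 5 := fun ⟨α, h⟩ ↦ (key α).mp h
    tfae_have 5 → 1 := fun h α ↦ (key α).mpr h
    tfae_have 3 ↔ 5 := isGoto_fiberProduct_iff hKc h1 hKT hTf hT n
    tfae_have 4 ↔ 5 := key 0
    tfae_have 5 ↔ 6 := by
      rw [← relLength_eq_length_quotient hKc h1 hKT (isLattice_of_finite T)]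
      rfl
    tfae_finish
  · have hKS : K ≤ S.toSubmodule := by
      rw [hS]
      exact Algebra.subset_adjoin
    have hSf : Module.Finite R S := by
      have h := (hKc.toIsLattice.pow (N + 1)).finite
      rw [← adjoin_eq_pow h1 (by omega) hKN, ← hS] at h
      exact h
    rintro _ rfl _ rfl
    subst hc
    have hJT : ∀ j ∈ colonIdeal S, ∀ t ∈ S, ∃ s : R,
        algebraMap R (FractionRing R) j * t = algebraMap R (FractionRing R) s :=
      fun j hj ↦ mem_colonIdeal.mp hj
    rw [fiberProductCanonical_eq _ S K hJT h1 hKS, idealizationCanonical_eq _ S K hJT h1 hKS,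
      (fiberProductData (colonIdeal S)).minGenerators_canonical_eq_one_iff S K hJT h1 hKS,
      (idealizationData (colonIdeal S)).minGenerators_canonical_eq_one_iff S K hJT h1 hKS,
      isGoto_and_minGenerators_iff hKc h1 hSf hS hKN]
    -- If `S = R` then the colon ideal is not proper and part (A) does not apply; but then `S / K =
    -- 0`, so the one-generator condition fails in all three statements.
    by_cases hne : S = ⊥
    · have hle : S.toSubmodule ≤ K := by
        rw [hne, Algebra.toSubmodule_bot]
        exact Submodule.one_le.mpr h1
      have hμ : minGenerators R (Subquotient S.toSubmodule K) ≠ 1 :=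
        fun h ↦ not_le_of_minGenerators_eq_one h hle
      simp only [hμ, List.tfae_cons_cons, List.tfae_singleton, and_false, and_true]
    · rw [isGoto_fiberProduct_iff hKc h1 hKS hSf hne,
        isGoto_quasiTrivialExtension_iff hKc h1 hKS hSf hne 0]
      simp only [List.tfae_cons_cons, List.tfae_singleton, and_true]
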